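/- Let $\mathbb F$ be a commutative ring. All operads are operads of differential graded $\mathbb F$-modules (lower $\mathbb Z$-grading, differential of degree $-1$, Koszul sign rule) considered in positive arities $r>0$. Let $\mathcal E$ be the Barratt–Eccles operad: $\mathcal E(r)_d$ is the $\mathbb F$-module generated by the tuples $(w_0,\dots,w_d)$ of permutations $w_i\in\Sigma_r$, where a tuple with $w_i=w_{i+1}$ for some $i$ is set equal to $0$; the differential is $\delta(w_0,\dots,w_d)=\sum_{i=0}^d(-1)^i(w_0,\dots,\widehat{w_i},\dots,w_d)$, the action is $\sigma\cdot(w_0,\dots,w_d)=(\sigma w_0,\dots,\sigma w_d)$, the unit is $(1)\in\mathcal E(1)_0$, and the partial composition products are $$(u_0,\dots,u_d)\circ_k(v_0,\dots,v_e)=\sum_{(x_*,y_*)}\pm(u_{x_0}\circ_kv_{y_0},\dots,u_{x_{d+e}}\circ_kv_{y_{d+e}}),$$ where the sum ranges over the lattice paths from $(0,0)$ to $(d,e)$ with unit steps to the right or upwards, the sign is the signature of the shuffle that moves the horizontal steps before the vertical ones, and $u\circ_kv$, for permutations $u\in\Sigma_r$ and $v\in\Sigma_s$, is obtained from the sequence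 $(u(1),\dots,u(r))$ by replacing the entry $k$ by $(v(1)+k-1,\dots,v(s)+k-1)$ and increasing the entries greater than $k$ by $s-1$. Let $\Lambda^*\mathcal E$ be the operadic suspension of $\mathcal E$: $\Lambda^*\mathcal E(r)_d=\operatorname{sgn}(r)\otimes\mathcal E(r)_{d-r+1}$, and $\Lambda^*w\in\Lambda^*\mathcal E(r)_{d+r-1}$ denotes the element corresponding to $w\in\mathcal E(r)_d$. Its structure is the one for which the operations $$(\Lambda^*w)(\mathbf e\otimes a_1,\dots,\mathbf e\otimes a_r)=(-1)^{\deg(w)r+\deg(a_1)(r-1)+\cdots+\deg(a_{r-1})}\,\mathbf e\otimes w(a_1,\dots,a_r),$$ with $\mathbf e$ of upper degree $1$, make the suspension $\mathbf e\otimes A$ of any $\mathcal E$-algebra $A$ a $\Lambda^*\mathcal E$-algebra. Explicitly, for $u\in\mathcal E(r)$ and $v\in\mathcal E(s)$, the unit is $\Lambda^*1$, and $$\delta(\Lambda^*u)=(-1)^{r-1}\Lambda^*(\delta u),\qquad \sigma\cdot\Lambda^*u=\operatorname{sgn}(\sigma)\,\Lambda^*(\sigma\cdot u),\qquad \Lambda^*u\circ_k\Lambda^*v=(-1)^{(s-1)(k-1)+(s-1)\deg(u)}\Lambda^*(u\circ_kv).$$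 For $r>0$, let $\epsilon_r:\mathcal E(r)_{r-1}\to\mathbb F$ be the cochain with $\epsilon_r(w_0,\dots,w_{r-1})=\operatorname{sgn}(w_0(1),\dots,w_{r-1}(1))$ if $(w_0(1),\dots,w_{r-1}(1))$ is a permutation of $(1,\dots,r)$, and $\epsilon_r(w_0,\dots,w_{r-1})=0$ otherwise. Let $\epsilon_r\cap-:\mathcal E(r)_n\to\mathcal E(r)_{n-r+1}$ be the cap product $$\epsilon_r\cap(w_0,\dots,w_n)=\epsilon_r(w_0,\dots,w_{r-1})\cdot(w_{r-1},\dots,w_n),$$ which is $0$ for $n<r-1$. Then the cap products with the fundamental cochains, taken with the sign $(-1)^{r(r-1)/2}$, that is, the maps $$\mathcal E(r)_n\to\Lambda^*\mathcal E(r)_n,\qquad w\mapsto(-1)^{r(r-1)/2}\,\Lambda^*(\epsilon_r\cap w),\qquad r>0,$$ define a morphism of operads $\mathcal E\to\Lambda^*\mathcal E$: they are well-defined linear maps which commute with the differentials, the actions of the symmetric groups, the operad units and the (partial) composition products. -/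

import Mathlib

/-!
# The Barratt-Eccles operad, the operadic suspension, and cap products

Only positive arities occur. An arity is written `m + 1` with `m : ℕ`, so that the partial
composite of operations of arities `m + 1` and `n + 1` has arity `m + n + 1`. Inputs are numbered
from `0`.
-/

noncomputable section

universe u

/-! ## Operads of dg-modules -/

/-- The structure maps of an operad in (lower graded) dg-modules over `F`, in positive arities,
given by partial composition products. `obj m d` is the component of arity `m + 1` and degree `d`.
Equations between degrees are passed as hypotheses to avoid casts. -/
structure DGOperadData (F : Type u) [CommRing F] where
  /-- operations of arity `m + 1` and degree `d` -/
  obj : ℕ → ℤ → Type u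
  [addCommGroup : ∀ m d, AddCommGroup (obj m d)]
  [module : ∀ m d, Module F (obj m d)]
  /-- the differential, of degree `-1` -/
  diff : ∀ (m : ℕ) (d d' : ℤ), d' + 1 = d → (obj m d →ₗ[F] obj m d')
  /-- the left action of the symmetric group -/
  act : ∀ (m : ℕ) (d : ℤ), Equiv.Perm (Fin (m + 1)) → (obj m d →ₗ[F] obj m d)
  /-- the operad unit -/
  one : ∀ d : ℤ, d = 0 → obj 0 d
  /-- the partial composition product `p ∘_k q`, where `q` is substituted in the input `k` -/
  comp : ∀ (m n : ℕ) (_k : Fin (m + 1)) (d e f : ℤ), d + e = f →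
    (obj m d →ₗ[F] obj n e →ₗ[F] obj (m + n) f)

attribute [instance] DGOperadData.addCommGroup DGOperadData.module

/-- A family of linear maps of degree `0` is a morphism of dg-operads if it commutes with the
differentials, the actions of the symmetric groups, the units and the composition products. -/
structure IsDGOperadMorphism {F : Type u} [CommRing F] (P Q : DGOperadData F)
    (φ : ∀ (m : ℕ) (d : ℤ), P.obj m d →ₗ[F] Q.obj m d) : Prop where
  map_diff : ∀ (m : ℕ) (d d' : ℤ) (h : d' + 1 = d) (p : P.obj m d),
    φ m d' (P.diff m d d' h p) = Q.diff m d d' h (φ m d p)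
  map_act : ∀ (m : ℕ) (d : ℤ) (σ : Equiv.Perm (Fin (m + 1))) (p : P.obj m d),
    φ m d (P.act m d σ p) = Q.act m d σ (φ m d p)
  map_one : ∀ (d : ℤ) (h : d = 0), φ 0 d (P.one d h) = Q.one d h
  map_comp : ∀ (m n : ℕ) (k : Fin (m + 1)) (d e f : ℤ) (h : d + e = f)
    (p : P.obj m d) (q : P.obj n e),
    φ (m + n) f (P.comp m n k d e f h p q) = Q.comp m n k d e f h (φ m d p) (φ n e q)

/-- The operadic suspension `Λ^* P`. Its component of arity `r = m + 1` and degree `d` is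
`sgn(r) ⊗ P(r)_{d - r + 1}`; the element which corresponds to `p` is denoted by `Λ^* p`.
Let `e` be a symbol of upper degree `1`, and for a `P`-algebra `A` let `Λ^* p` act on `e ⊗ A` by
`(Λ^* p)(e ⊗ a_1, …, e ⊗ a_r) = ± e ⊗ p(a_1, …, a_r)`, where the sign has exponent
`deg(p) r + deg(a_1) (r - 1) + ⋯ + deg(a_{r-1})`. The composite of such operations gives
`(Λ^* p) ∘_k (Λ^* q) = (-1)^{(s - 1)(k - 1) + (s - 1) deg(p)} Λ^* (p ∘_k q)`
for `q` of arity `s` (with `k` numbered from `1`), and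
`δ(Λ^* p) = (-1)^{r - 1} Λ^* (δ p)`, `σ · Λ^* p = sgn(σ) Λ^* (σ · p)`. -/
def operadicSuspension {F : Type u} [CommRing F] (P : DGOperadData F) : DGOperadData F where
  obj m d := P.obj m (d - m)
  diff m d d' h := ((-1 : ℤˣ) ^ m) • P.diff m (d - m) (d' - m) (by omega)
  act m d σ := Equiv.Perm.sign σ • P.act m (d - m) σ
  one d h := P.one (d - (0 : ℕ)) (by simpa using h)
  comp m n k d e f h :=
    ((-1 : ℤˣ) ^ (n * (k : ℕ)) * ((-1 : ℤˣ) ^ (d - m)) ^ n) •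
      P.comp m n k (d - m) (e - n) (f - (m + n : ℕ)) (by push_cast; omega)

/-! ## Normalized chains of the contractible simplicial set `W(X)` -/

namespace BarrattEccles

section Chains

variable (F : Type u) [CommRing F] (X : Type) {Y Z : Type}

/-- A tuple in which two consecutive entries are equal. -/
def HasRepeat {X : Type} (l : List X) : Prop := ∃ a x b, l = a ++ x :: x :: b

/-- The span of the degenerate tuples (and of the empty tuple, which is not a simplex). -/
def degenerate : Submodule F (List X →₀ F) :=
  Submodule.span F {c | ∃ l : List X, (l = [] ∨ HasRepeat l) ∧ c = Finsupp.single l 1}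

/-- The normalized chains `N_*(W(X))`: generated by the nonempty tuples `(x_0, …, x_d)`, where the
tuples with equal consecutive entries vanish. -/
abbrev Chain : Type u := (List X →₀ F) ⧸ degenerate F X

variable {X}

/-- The class of the tuple `(x_0, …, x_d)`. -/
def tuple (l : List X) : Chain F X := (degenerate F X).mkQ (Finsupp.single l 1)

theorem tuple_eq_zero {l : List X} (h : l = [] ∨ HasRepeat l) : tuple F l = 0 := by
  rw [tuple, Submodule.mkQ_apply, Submodule.Quotient.mk_eq_zero]
  exact Submodule.subset_span ⟨l, h, rfl⟩

/-- A linear map on normalized chains, given by its values on tuples. -/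
def lift {M : Type u} [AddCommGroup M] [Module F M] (g : List X → M)
    (hg : ∀ l, l = [] ∨ HasRepeat l → g l = 0) : Chain F X →ₗ[F] M :=
  (degenerate F X).liftQ (Finsupp.linearCombination F g) (by
    rw [degenerate, Submodule.span_le]
    rintro _ ⟨l, hl, rfl⟩
    simp [hg l hl])

theorem lift_tuple {M : Type u} [AddCommGroup M] [Module F M] (g : List X → M)
    (hg : ∀ l, l = [] ∨ HasRepeat l → g l = 0) (l : List X) :
    lift F g hg (tuple F l) = g l := by
  simp [lift, tuple]

variable (X) in
/-- The chains of degree `d`, spanned by the tuples with `d + 1` entries. -/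
def deg (d : ℤ) : Submodule F (Chain F X) :=
  Submodule.span F {c | ∃ l : List X, (l.length : ℤ) = d + 1 ∧ c = tuple F l}

theorem tuple_mem {l : List X} {d : ℤ} (h : (l.length : ℤ) = d + 1) : tuple F l ∈ deg F X d :=
  Submodule.subset_span ⟨l, h, rfl⟩

theorem map_mem {M : Type u} [AddCommGroup M] [Module F M] (φ : Chain F X →ₗ[F] M)
    (S : Submodule F M) (d : ℤ)
    (h : ∀ l : List X, (l.length : ℤ) = d + 1 → φ (tuple F l) ∈ S)
    (c : Chain F X) (hc : c ∈ deg F X d) : φ c ∈ S := by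
  have : deg F X d ≤ S.comap φ := by
    rw [deg, Submodule.span_le]
    rintro _ ⟨l, hl, rfl⟩
    exact h l hl
  exact this hc

/-- `(x_0, …, x_d) ↦ ∑ (-1)^i (x_0, …, x_i omitted, …, x_d)`. -/
def boundaryTuple (l : List X) : Chain F X :=
  ∑ i ∈ Finset.range l.length, ((-1 : ℤˣ) ^ i) • tuple F (l.eraseIdx i)

theorem boundaryTuple_degenerate (l : List X) (h : l = [] ∨ HasRepeat l) :
    boundaryTuple F l = 0 := by
  rcases h with rfl | ⟨a, x, b, rfl⟩
  · simp [boundaryTuple]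
  · rw [boundaryTuple, Finset.sum_eq_add a.length (a.length + 1) (by omega)]
    · have h₁ : (a ++ x :: x :: b).eraseIdx (a.length + 1) = a ++ x :: b := by
        rw [List.eraseIdx_append_of_length_le (by omega)]; simp
      have h₂ : (a ++ x :: x :: b).eraseIdx a.length = a ++ x :: b := by
        rw [List.eraseIdx_append_of_length_le (by omega)]; simp
      rw [h₁, h₂, pow_succ]
      simp [Units.smul_def]
    · rintro i - ⟨h₁, h₂⟩
      rw [tuple_eq_zero F, smul_zero]
      right
      rcases Nat.lt_or_ge i a.length with hi | hi
      · exact ⟨a.eraseIdx i, x, b, by rw [List.eraseIdx_append_of_lt_length hi]⟩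
      · obtain ⟨j, rfl⟩ : ∃ j, i = a.length + (j + 2) := ⟨i - a.length - 2, by omega⟩
        refine ⟨a, x, b.eraseIdx j, ?_⟩
        rw [List.eraseIdx_append_of_length_le (by omega)]
        simp
    · intro h; simp at h
    · intro h; simp at h

/-- The differential of the normalized chains. -/
def boundary : Chain F X →ₗ[F] Chain F X := lift F (boundaryTuple F) (boundaryTuple_degenerate F)

theorem boundary_mem (d d' : ℤ) (h : d' + 1 = d) (c : Chain F X) (hc : c ∈ deg F X d) :
    boundary F c ∈ deg F X d' := by
  refine map_mem F _ _ d (fun l hl => ?_) c hc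
  rw [boundary, lift_tuple, boundaryTuple]
  refine Submodule.sum_mem _ fun i hi => ?_
  rw [Units.smul_def]
  refine zsmul_mem (tuple_mem F ?_) _
  rw [List.length_eraseIdx_of_lt (by simpa using hi)]
  have := Finset.mem_range.1 hi
  omega

/-- The map of normalized chains induced by a map of sets. -/
def mapTuple (g : X → Y) : Chain F X →ₗ[F] Chain F Y :=
  lift F (fun l => tuple F (l.map g)) (by
    rintro l (rfl | ⟨a, x, b, rfl⟩)
    · exact tuple_eq_zero F (Or.inl rfl)
    · exact tuple_eq_zero F (Or.inr ⟨a.map g, g x, b.map g, by simp⟩))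

theorem mapTuple_mem (g : X → Y) (d : ℤ) (c : Chain F X) (hc : c ∈ deg F X d) :
    mapTuple F g c ∈ deg F Y d := by
  refine map_mem F _ _ d (fun l hl => ?_) c hc
  rw [mapTuple, lift_tuple]
  exact tuple_mem F (by simpa using hl)

/-- The Eilenberg-Zilber product of the tuples `(x_0, …, x_d)` and `(y_0, …, y_e)`, with the pairs
of entries combined by `g`: the signed sum of the tuples
`(g x_{i_0} y_{j_0}, …, g x_{i_{d+e}} y_{j_{d+e}})` over all lattice paths `(i_*, j_*)` from
`(0, 0)` to `(d, e)` with unit steps in one of the two directions. The sign is the signature of the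
shuffle which moves the horizontal steps (in the `x`-direction) before the vertical ones.
The paths are enumerated by their first step: a horizontal first step gives no sign,
and a vertical first step is moved across all the `d` horizontal steps. -/
def shuffle (g : X → Y → Z) : List X → List Y → (List Z →₀ F)
  | [], _ => 0
  | _ :: _, [] => 0
  | [x], [y] => Finsupp.single [g x y] 1
  | x :: xs, y :: ys => Finsupp.mapDomain (List.cons (g x y))
      (shuffle g xs (y :: ys) + ((-1 : ℤˣ) ^ xs.length) • shuffle g (x :: xs) ys)
  termination_by xs ys => xs.length + ys.length

theorem shuffle_support (g : X → Y → Z) (xs : List X) (ys : List Y) :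
    shuffle F g xs ys ∈ Submodule.span F
      {c : List Z →₀ F | ∃ l : List Z, l.length + 1 = xs.length + ys.length ∧
        ((HasRepeat xs ∨ HasRepeat ys) → HasRepeat l) ∧
        (∀ x y, xs.head? = some x → ys.head? = some y → l.head? = some (g x y)) ∧
        c = Finsupp.single l 1} := by
  have hcons : ∀ {W : Type} (w w' : W) (l : List W), HasRepeat (w :: w' :: l) →
      w = w' ∨ HasRepeat (w' :: l) := by
    rintro W w w' l ⟨a, x, b, h⟩
    rcases a with _ | ⟨a, as⟩
    · simp only [List.nil_append, List.cons.injEq] at h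
      exact Or.inl (h.1.trans h.2.1.symm)
    · simp only [List.cons_append, List.cons.injEq] at h
      exact Or.inr ⟨as, x, b, h.2⟩
  have hone : ∀ {W : Type} (w : W), ¬ HasRepeat [w] := by
    rintro W w ⟨a, x, b, h⟩
    have := congrArg List.length h
    simp at this
    omega
  have hrep : ∀ {W : Type} (w : W) (l : List W), HasRepeat l → HasRepeat (w :: l) := by
    rintro W w l ⟨a, x, b, rfl⟩
    exact ⟨w :: a, x, b, rfl⟩
  have hhead : ∀ {W : Type} (w : W) (l : List W), l.head? = some w → HasRepeat (w :: l) := by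
    rintro W w l h
    rcases l with _ | ⟨v, l⟩
    · simp at h
    · obtain rfl : v = w := by simpa using h
      exact ⟨[], v, l, rfl⟩
  fun_induction shuffle F g xs ys with
  | case1 => exact zero_mem _
  | case2 => exact zero_mem _
  | case3 x y =>
    refine Submodule.subset_span ⟨_, by simp, ?_, by simp, rfl⟩
    rintro (h | h) <;> exact absurd h (hone _)
  | case4 x xs y ys hne ih₁ ih₂ =>
    have key : ∀ (us : List X) (vs : List Y),
        us.length + vs.length = xs.length + ys.length + 1 →
        (HasRepeat (x :: xs) ∨ HasRepeat (y :: ys) → (HasRepeat us ∨ HasRepeat vs) ∨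
          (us.head? = some x ∧ vs.head? = some y) ∨ us = [] ∨ vs = []) →
        shuffle F g us vs ∈ Submodule.span F
          {c : List Z →₀ F | ∃ l : List Z, l.length + 1 = us.length + vs.length ∧
            ((HasRepeat us ∨ HasRepeat vs) → HasRepeat l) ∧
            (∀ x y, us.head? = some x → vs.head? = some y → l.head? = some (g x y)) ∧
            c = Finsupp.single l 1} →
        Finsupp.mapDomain (List.cons (g x y)) (shuffle F g us vs) ∈ Submodule.span F
          {c : List Z →₀ F | ∃ l : List Z, l.length + 1 = (x :: xs).length + (y :: ys).length ∧
            ((HasRepeat (x :: xs) ∨ HasRepeat (y :: ys)) → HasRepeat l) ∧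
            (∀ x' y', (x :: xs).head? = some x' → (y :: ys).head? = some y' →
              l.head? = some (g x' y')) ∧
            c = Finsupp.single l 1} := by
      intro us vs hlen himp hmem
      by_cases hnil : us = [] ∨ vs = []
      · have : shuffle F g us vs = 0 := by
          rcases hnil with rfl | rfl
          · simp [shuffle]
          · cases us <;> simp [shuffle]
        simp [this]
      · change Finsupp.lmapDomain F F (List.cons (g x y)) (shuffle F g us vs) ∈ _
        rw [← Submodule.mem_comap]
        refine Submodule.span_le.2 ?_ hmem
        rintro _ ⟨l, hl, hl', hl'', rfl⟩
        refine Submodule.subset_span ⟨g x y :: l, by simp; omega, ?_, by simp, by simp⟩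
        intro h
        rcases himp h with h | h | h
        · exact hrep _ _ (hl' h)
        · exact hhead _ _ (hl'' x y h.1 h.2)
        · exact absurd h hnil
    rw [Finsupp.mapDomain_add]
    refine add_mem (key xs (y :: ys) (by simp; omega) ?_ ih₁) ?_
    · rintro (h | h)
      · rcases xs with _ | ⟨x', xs⟩
        · exact absurd h (hone _)
        · rcases hcons _ _ _ h with rfl | h
          · exact Or.inr (Or.inl ⟨rfl, rfl⟩)
          · exact Or.inl (Or.inl h)
      · exact Or.inl (Or.inr h)
    · have hs : Finsupp.mapDomain (List.cons (g x y))
          (((-1 : ℤˣ) ^ xs.length) • shuffle F g (x :: xs) ys) =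
          (((-1 : ℤˣ) ^ xs.length : ℤˣ) : ℤ) • Finsupp.mapDomain (List.cons (g x y))
            (shuffle F g (x :: xs) ys) := by
        rw [Units.smul_def]
        exact map_zsmul (Finsupp.lmapDomain F F (List.cons (g x y))) _ _
      rw [hs]
      refine zsmul_mem (key (x :: xs) ys (by simp; omega) ?_ ih₂) _
      rintro (h | h)
      · exact Or.inl (Or.inl h)
      · rcases ys with _ | ⟨y', ys⟩
        · exact absurd h (hone _)
        · rcases hcons _ _ _ h with rfl | h
          · exact Or.inr (Or.inl ⟨rfl, rfl⟩)
          · exact Or.inl (Or.inr h)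

/-- The class of the Eilenberg-Zilber product of two tuples in the normalized chains. -/
def ezTuple (g : X → Y → Z) (xs : List X) (ys : List Y) : Chain F Z :=
  (degenerate F Z).mkQ (shuffle F g xs ys)

theorem ezTuple_degenerate (g : X → Y → Z) (xs : List X) (ys : List Y)
    (h : (xs = [] ∨ HasRepeat xs) ∨ (ys = [] ∨ HasRepeat ys)) : ezTuple F g xs ys = 0 := by
  have h' : (xs = [] ∨ ys = []) ∨ (HasRepeat xs ∨ HasRepeat ys) := by tauto
  rcases h' with h' | h'
  · have : shuffle F g xs ys = 0 := by
      rcases h' with rfl | rfl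
      · simp [shuffle]
      · cases xs <;> simp [shuffle]
    simp [ezTuple, this]
  · rw [ezTuple, Submodule.mkQ_apply, Submodule.Quotient.mk_eq_zero]
    refine Submodule.span_le.2 ?_ (shuffle_support F g xs ys)
    rintro _ ⟨l, -, hl, -, rfl⟩
    exact Submodule.subset_span ⟨l, Or.inr (hl h'), rfl⟩

/-- The Eilenberg-Zilber product `N_*(W(X)) ⊗ N_*(W(Y)) → N_*(W(X × Y)) → N_*(W(Z))`. -/
def ez (g : X → Y → Z) : Chain F X →ₗ[F] Chain F Y →ₗ[F] Chain F Z :=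
  lift F (fun xs => lift F (ezTuple F g xs)
      (fun ys h => ezTuple_degenerate F g xs ys (Or.inr h)))
    (fun xs h => by
      refine Submodule.linearMap_qext _ (Finsupp.lhom_ext' fun ys => LinearMap.ext_ring ?_)
      exact (lift_tuple F (ezTuple F g xs)
        (fun ys h => ezTuple_degenerate F g xs ys (Or.inr h)) ys).trans
        (ezTuple_degenerate F g xs ys (Or.inl h)))

theorem ez_mem (g : X → Y → Z) (d e f : ℤ) (h : d + e = f) (a : Chain F X) (ha : a ∈ deg F X d)
    (b : Chain F Y) (hb : b ∈ deg F Y e) : ez F g a b ∈ deg F Z f := by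
  refine map_mem F ((ez F g).flip b) _ d (fun xs hxs => ?_) a ha
  refine map_mem F (ez F g (tuple F xs)) _ e (fun ys hys => ?_) b hb
  have : ez F g (tuple F xs) (tuple F ys) = ezTuple F g xs ys := by
    rw [ez, lift_tuple, lift_tuple]
  rw [this, ezTuple, ← Submodule.mem_comap]
  refine Submodule.span_le.2 ?_ (shuffle_support F g xs ys)
  rintro _ ⟨l, hl, -, -, rfl⟩
  exact tuple_mem F (by omega)

end Chains

/-! ## The permutation operad -/

/-- The letter `a ≠ k` of a word in `0, …, m` after `k` has been replaced by a block of `n + 1`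
letters: the letters greater than `k` are increased by `n`. -/
def shiftLetter {m : ℕ} (n : ℕ) (k a : Fin (m + 1)) : Fin (m + n + 1) :=
  if a < k then ⟨a, by omega⟩ else ⟨a + n, by omega⟩

/-- The word of `u ∘_k v`: in `(u(0), …, u(m))`, the occurrence of `k` is replaced by
`(v(0) + k, …, v(n) + k)`, and the letters greater than `k` are increased by `n`. -/
def permCompFun {m n : ℕ} (k : Fin (m + 1)) (u : Equiv.Perm (Fin (m + 1)))
    (v : Equiv.Perm (Fin (n + 1))) (i : Fin (m + n + 1)) : Fin (m + n + 1) :=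
  if h₁ : (i : ℕ) < u.symm k then shiftLetter n k (u ⟨i, by omega⟩)
  else if h₂ : (i : ℕ) ≤ u.symm k + n then
    ⟨k + v ⟨i - u.symm k, by omega⟩, by omega⟩
  else shiftLetter n k (u ⟨i - n, by omega⟩)

theorem permCompFun_symm {m n : ℕ} (k : Fin (m + 1)) (u : Equiv.Perm (Fin (m + 1)))
    (v : Equiv.Perm (Fin (n + 1))) (i : Fin (m + n + 1)) :
    permCompFun (u.symm k) u.symm v.symm (permCompFun k u v i) = i := by
  have key : ∀ (j : Fin (m + 1)), j ≠ u.symm k →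
      permCompFun (u.symm k) u.symm v.symm (shiftLetter n k (u j)) =
        shiftLetter n (u.symm k) j := by
    intro j hj
    have hne : u j ≠ k := fun h => hj (by rw [← h, Equiv.symm_apply_apply])
    have hval : ((u j : Fin (m + 1)) : ℕ) ≠ (k : ℕ) := fun h => hne (Fin.ext h)
    unfold permCompFun
    simp only [Equiv.symm_symm, Equiv.apply_symm_apply]
    by_cases hlt : u j < k
    · have hs : shiftLetter n k (u j) = ⟨u j, by omega⟩ := by simp [shiftLetter, hlt]
      have hlt' : ((u j : Fin (m + 1)) : ℕ) < (k : ℕ) := hlt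
      simp [hs, hlt']
    · have hs : shiftLetter n k (u j) = ⟨u j + n, by omega⟩ := by simp [shiftLetter, hlt]
      have hlt' : ¬ ((u j : Fin (m + 1)) : ℕ) < (k : ℕ) := hlt
      have h₁ : ¬ ((u j : Fin (m + 1)) : ℕ) + n < (k : ℕ) := by omega
      have h₂ : ¬ ((u j : Fin (m + 1)) : ℕ) + n ≤ (k : ℕ) + n := by omega
      rw [hs]
      simp [h₁]
      intro h
      omega
  rcases lt_trichotomy (i : ℕ) (u.symm k) with h | h | h
  · have h0 : permCompFun k u v i = shiftLetter n k (u ⟨i, by omega⟩) := by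
      simp [permCompFun, h]
    rw [h0, key _ (fun hh => by rw [← hh] at h; simp at h)]
    ext
    simp [shiftLetter, Fin.lt_def, h]
  all_goals
    have hn : ¬ (i : ℕ) < u.symm k := by omega
    by_cases h₂ : (i : ℕ) ≤ u.symm k + n
    · have h0 : permCompFun k u v i = ⟨k + v ⟨i - u.symm k, by omega⟩, by omega⟩ := by
        simp [permCompFun, hn, h₂]
      rw [h0]
      unfold permCompFun
      have h₃ : (v ⟨i - u.symm k, by omega⟩ : ℕ) ≤ n := by omega
      ext
      simp [h₃]
      omega
    · have h0 : permCompFun k u v i = shiftLetter n k (u ⟨i - n, by omega⟩) := by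
        simp [permCompFun, hn, h₂]
      rw [h0, key _ (fun hh => by have := congrArg Fin.val hh; simp at this; omega)]
      have h₄ : ¬ ((i : ℕ) - n < u.symm k) := by omega
      ext
      simp [shiftLetter, Fin.lt_def, h₄]
      omega

/-- The partial composite `u ∘_k v` in the permutation operad. -/
def permComp {m n : ℕ} (k : Fin (m + 1)) (u : Equiv.Perm (Fin (m + 1)))
    (v : Equiv.Perm (Fin (n + 1))) : Equiv.Perm (Fin (m + n + 1)) where
  toFun := permCompFun k u v
  invFun := permCompFun (u.symm k) u.symm v.symm
  left_inv := permCompFun_symm k u v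
  right_inv i := by
    have := permCompFun_symm (u.symm k) u.symm v.symm i
    simpa using this

/-! ## The Barratt-Eccles operad -/

end BarrattEccles

open BarrattEccles in
/-- The Barratt-Eccles operad `ℰ`: the normalized chains of the simplicial operad `W(Σ_r)`, with
the diagonal action `σ · (w_0, …, w_d) = (σ w_0, …, σ w_d)` and with the composition product
induced by the one of permutations and by the Eilenberg-Zilber product. -/
def barrattEccles (F : Type u) [CommRing F] : DGOperadData F where
  obj m d := deg F (Equiv.Perm (Fin (m + 1))) d
  addCommGroup _ _ := inferInstance
  module _ _ := inferInstance
  diff _ d d' h := (boundary F).restrict (boundary_mem F d d' h)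
  act _ d σ := (mapTuple F (fun w => σ * w)).restrict (mapTuple_mem F (fun w => σ * w) d)
  one d h := ⟨tuple F [1], tuple_mem F (by simp [h])⟩
  comp _ _ k d e f h := LinearMap.mk₂ F
    (fun a b => ⟨ez F (permComp k) a.1 b.1, ez_mem F _ d e f h a.1 a.2 b.1 b.2⟩)
    (fun _ _ _ => Subtype.ext (by simp)) (fun _ _ _ => Subtype.ext (by simp))
    (fun _ _ _ => Subtype.ext (by simp)) (fun _ _ _ => Subtype.ext (by simp))

/-! ## The fundamental cochains and their cap products -/

namespace BarrattEccles

/-- The fundamental cochain `ε_r`, `r = m + 1`, on tuples of elements of `Σ_r`. It maps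
`(w_0, …, w_d)` to the signature of the sequence of first values `(w_0(1), …, w_d(1))` if this
sequence is a permutation of `(1, …, r)`, and to `0` otherwise. (At most one `σ` contributes to
the sum.) -/
def fundamentalCochain (F : Type u) [CommRing F] {m : ℕ}
    (l : List (Equiv.Perm (Fin (m + 1)))) : F :=
  ∑ σ : Equiv.Perm (Fin (m + 1)),
    if List.ofFn σ = l.map (fun w => w 0) then ((Equiv.Perm.sign σ : ℤ) : F) else 0

theorem fundamentalCochain_eq_zero (F : Type u) [CommRing F] {m : ℕ}
    (l : List (Equiv.Perm (Fin (m + 1)))) (h : l.length ≠ m + 1 ∨ HasRepeat l) :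
    fundamentalCochain F l = 0 := by
  refine Finset.sum_eq_zero fun σ _ => if_neg fun hσ => ?_
  rcases h with h | ⟨a, x, b, rfl⟩
  · exact h (by simpa using (congrArg List.length hσ).symm)
  · have hnd : (List.ofFn σ).Nodup := List.nodup_ofFn.2 σ.injective
    rw [hσ] at hnd
    simp [List.nodup_append] at hnd

/-- The cap product `ε_r ∩ (w_0, …, w_n) = ε_r(w_0, …, w_{r-1}) · (w_{r-1}, …, w_n)`,
`r = m + 1`. -/
def capTuple (F : Type u) [CommRing F] {m : ℕ} (l : List (Equiv.Perm (Fin (m + 1)))) :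
    Chain F (Equiv.Perm (Fin (m + 1))) :=
  fundamentalCochain F (l.take (m + 1)) • tuple F (l.drop m)

theorem capTuple_degenerate (F : Type u) [CommRing F] {m : ℕ}
    (l : List (Equiv.Perm (Fin (m + 1)))) (h : l = [] ∨ HasRepeat l) : capTuple F l = 0 := by
  rcases h with rfl | ⟨a, x, b, rfl⟩
  · simp [capTuple, tuple_eq_zero F (Or.inl rfl)]
  · rcases Nat.lt_or_ge a.length m with hm | hm
    · rw [capTuple, fundamentalCochain_eq_zero, zero_smul]
      right
      refine ⟨a, x, b.take (m - a.length - 1), ?_⟩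
      rw [List.take_append, List.take_of_length_le (by omega),
        show m + 1 - a.length = (m - a.length - 1) + 1 + 1 by omega]
      simp
    · rw [capTuple, tuple_eq_zero F, smul_zero]
      right
      exact ⟨a.drop m, x, b, by rw [List.drop_append_of_le_length hm]⟩

/-- The cap product with the fundamental cochain as a linear map on chains. -/
def cap (F : Type u) [CommRing F] (m : ℕ) :
    Chain F (Equiv.Perm (Fin (m + 1))) →ₗ[F] Chain F (Equiv.Perm (Fin (m + 1))) :=
  lift F (capTuple F) (capTuple_degenerate F)

theorem cap_mem (F : Type u) [CommRing F] (m : ℕ) (d : ℤ)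
    (c : Chain F (Equiv.Perm (Fin (m + 1)))) (hc : c ∈ deg F (Equiv.Perm (Fin (m + 1))) d) :
    cap F m c ∈ deg F (Equiv.Perm (Fin (m + 1))) (d - m) := by
  refine map_mem F _ _ d (fun l hl => ?_) c hc
  rw [cap, lift_tuple, capTuple]
  rcases Nat.lt_or_ge l.length (m + 1) with h | h
  · rw [fundamentalCochain_eq_zero F _ (Or.inl (by simp; omega)), zero_smul]
    exact zero_mem _
  · exact Submodule.smul_mem _ _ (tuple_mem F (by rw [List.length_drop]; omega))

end BarrattEccles

open BarrattEccles in
/-- The cap product `ε_r ∩ - : ℰ(r)_d → ℰ(r)_{d - r + 1}`, `r = m + 1`. -/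
def capFundamental (F : Type u) [CommRing F] (m : ℕ) (d : ℤ) :
    (barrattEccles F).obj m d →ₗ[F] (barrattEccles F).obj m (d - m) :=
  (cap F m).restrict (cap_mem F m d)

end

/-! The cochain `ε_r` sees a tuple of permutations only through the word of its first letters, and
on that word it is the signature, extended by zero to words that are not permutations. The whole
statement reduces to facts about such words and about lattice paths.

Differential: a word of `r + 1` letters in an alphabet of size `r` repeats some letter `x`. Only the
deletion of one of two occurrences of `x` can leave a permutation, and the two resulting terms
differ by moving `x` across the letters in between, so they cancel. Thus the fundamental cochain is
a cocycle (`sum_wordSign_eraseIdx`), and the cap product commutes with the boundary up to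
`(-1)^(r-1)` (`cap_boundary`), which is the sign in the suspended differential. Equivariance is
multiplicativity of the signature.

Composition: cutting every lattice path after a fixed number of steps turns the cap product of a
shuffle into a sum over cut points `(a, b)` of a shuffle of fronts, evaluated by the cochain, times
a shuffle of backs (`shuffleSum_take_smul_drop`). The front value vanishes unless both fronts
contain all their letters, which forces `(a, b) = (m, n)` for arities `m + 1` and `n + 1`. In the
front, the first letter of `u ∘_k v` depends on `v` only when `u` starts with `k`, so the one path
that can give a nonzero term has all its vertical steps in the column of `k`. Its sign together with
the signature of the substituted permutation gives `(-1)^(n(m+k))`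
(`shuffleSum_wordSign_of_forall_mem`). The vertical steps of the front cross the horizontal steps of
the back, with sign `(-1)^(n(d-m))`.

The suspension asks for `(-1)^(nk + n(d-m))`. The excess `(-1)^(mn)` is the coboundary of the
normalization `(-1)^(m(m+1)/2)`. -/

namespace BarrattEccles

/-! ## The signature of a word -/

section Signature

/-- The signature of a word: `-1` to the number of its inversions. -/
def invSign : List ℕ → ℤˣ
  | [] => 1
  | x :: l => (-1) ^ l.countP (· < x) * invSign l

/-- The number of pairs `x ∈ l`, `y ∈ l'` with `y < x`. -/
def crossings (l l' : List ℕ) : ℕ := (l.map fun x => l'.countP (· < x)).sum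

theorem invSign_append (l l' : List ℕ) :
    invSign (l ++ l') = invSign l * invSign l' * (-1) ^ crossings l l' := by
  induction l with
  | nil => simp [invSign, crossings]
  | cons x l ih =>
    simp only [List.cons_append, invSign, ih, List.countP_append, crossings, List.map_cons,
      List.sum_cons, pow_add]
    simp only [mul_assoc, mul_left_comm, mul_comm]

theorem invSign_map {f : ℕ → ℕ} {l : List ℕ} (hf : ∀ x ∈ l, ∀ y ∈ l, f x < f y ↔ x < y) :
    invSign (l.map f) = invSign l := by
  induction l with
  | nil => rfl
  | cons x l ih =>
    rw [List.map_cons, invSign, invSign, List.countP_map,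
      ih fun a ha b hb => hf a (by simp [ha]) b (by simp [hb])]
    congr 2
    exact List.countP_congr fun y hy => by
      simpa using hf y (by simp [hy]) x (by simp)

theorem crossings_map {f : ℕ → ℕ} {l l' : List ℕ} (hf : ∀ x ∈ l, ∀ y ∈ l', f y < f x ↔ y < x) :
    crossings (l.map f) (l'.map f) = crossings l l' := by
  rw [crossings, crossings, List.map_map]
  congr 1
  refine List.map_congr_left fun x hx => ?_
  rw [Function.comp_apply, List.countP_map]
  exact List.countP_congr fun y hy => by simpa using hf x hx y hy

/-- The inversions between the prefix and the rest depend only on the multiset of letters of the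
rest. -/
theorem invSign_append_congr (a : List ℕ) {l l' : List ℕ} {s : ℤˣ} (hp : l.Perm l')
    (h : invSign l = s * invSign l') : invSign (a ++ l) = s * invSign (a ++ l') := by
  rw [invSign_append, invSign_append, h]
  have : crossings a l = crossings a l' := by
    rw [crossings, crossings]
    congr 1
    exact List.map_congr_left fun x _ => hp.countP_eq _
  rw [this]
  ac_rfl

/-- Moving `x` to the front is a chain of adjacent swaps with distinct letters, each of which
changes the parity of the inversions. -/
theorem invSign_append_cons (b c : List ℕ) (x : ℕ) (hx : x ∉ b) :
    invSign (b ++ x :: c) = (-1) ^ b.length * invSign (x :: (b ++ c)) := by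
  induction b with
  | nil => simp
  | cons y b ih =>
    obtain ⟨hxy, hxb⟩ : x ≠ y ∧ x ∉ b := by simpa using hx
    have h₁ : invSign (y :: b ++ x :: c) =
        (-1) ^ b.length * invSign (y :: x :: (b ++ c)) := by
      refine invSign_append_congr [y] (l := b ++ x :: c) (l' := x :: (b ++ c)) ?_ (ih hxb)
      exact List.perm_middle
    rw [h₁]
    simp only [invSign, List.cons_append, List.countP_cons, List.length_cons]
    rcases lt_or_gt_of_ne hxy with h | h
    · simp only [h, not_lt.2 h.le, decide_true, decide_false, pow_add, pow_succ]
      simp [mul_assoc, mul_left_comm, mul_comm]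
    · simp only [h, not_lt.2 h.le, decide_true, decide_false, pow_add, pow_succ]
      simp [mul_assoc, mul_left_comm, mul_comm]

/-- Connects the recursive inversion count to the product over pairs `i < j` in
`Equiv.Perm.sign_eq_prod_prod_Ioi`. -/
theorem invSign_ofFn {n : ℕ} (f : Fin n → ℕ) :
    invSign (List.ofFn f) = ∏ i, ∏ j ∈ Finset.Ioi i, if f j < f i then -1 else 1 := by
  induction n with
  | zero => simp [invSign]
  | succ n ih =>
    rw [List.ofFn_succ, invSign, ih, Fin.prod_univ_succ]
    congr 1
    · rw [Fin.Ioi_zero_eq_map, Finset.prod_map]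
      simp only [Fin.coe_succEmb]
      -- The first letter is decoupled from the rest so that the inner induction can vary the word
      -- while keeping the letter it is compared with.
      generalize f 0 = x
      generalize hg : (fun i : Fin n => f i.succ) = g
      have hg' : ∀ i, f (Fin.succ i) = g i := fun i => by rw [← hg]
      simp only [hg']
      clear ih hg hg' f
      induction n with
      | zero => simp
      | succ n ih =>
        rw [List.ofFn_succ, List.countP_cons, pow_add, ih, Fin.prod_univ_succ, mul_comm]
        congr 1
        split_ifs <;> simp_all
    · refine Finset.prod_congr rfl fun i _ => ?_
      rw [Fin.Ioi_succ, Finset.prod_map]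
      rfl

theorem sign_eq_invSign {n : ℕ} (σ : Equiv.Perm (Fin n)) :
    Equiv.Perm.sign σ = invSign ((List.ofFn σ).map Fin.val) := by
  rw [List.map_ofFn, invSign_ofFn, Equiv.Perm.sign_eq_prod_prod_Ioi]
  refine Finset.prod_congr rfl fun i _ => Finset.prod_congr rfl fun j hj => ?_
  have hne : σ i ≠ σ j := fun h => (Finset.mem_Ioi.1 hj).ne (σ.injective h)
  rcases lt_or_gt_of_ne hne with h | h
  · rw [if_pos h, if_neg (by simpa using h.le)]
  · rw [if_neg (by simpa using h.le), if_pos (by simpa using h)]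

/-! ### The signature extended by zero to arbitrary words -/

variable (F : Type u) [CommRing F] {N : ℕ}

/-- The signature of a word in the letters `0, …, N - 1` if it is a permutation of the letters, and
`0` otherwise. -/
noncomputable def wordSign (l : List (Fin N)) : F :=
  ∑ σ : Equiv.Perm (Fin N), if List.ofFn σ = l then ((Equiv.Perm.sign σ : ℤ) : F) else 0

theorem nodup_of_forall_mem {l : List (Fin N)} (hl : l.length = N) (h : ∀ z, z ∈ l) :
    l.Nodup := by
  have h₁ : l.toFinset = Finset.univ := by ext z; simp [h z]
  have h₂ := congrArg Finset.card h₁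
  rw [Finset.card_univ, Fintype.card_fin] at h₂
  rw [← Multiset.coe_nodup, ← Multiset.toFinset_card_eq_card_iff_nodup]
  exact h₂.trans hl.symm

theorem le_length_of_forall_mem {l : List (Fin N)} (h : ∀ z, z ∈ l) : N ≤ l.length := by
  have h₁ : l.toFinset = Finset.univ := by ext z; simp [h z]
  have h₂ := congrArg Finset.card h₁
  rw [Finset.card_univ, Fintype.card_fin] at h₂
  exact h₂.symm.le.trans (List.toFinset_card_le l)

theorem wordSign_ofFn (σ : Equiv.Perm (Fin N)) :
    wordSign F (List.ofFn σ) = ((Equiv.Perm.sign σ : ℤ) : F) := by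
  rw [wordSign, Finset.sum_eq_single σ]
  · simp
  · intro τ _ hτ
    rw [if_neg]
    exact fun h => hτ (Equiv.ext fun i => congrFun (List.ofFn_injective h) i)
  · simp

theorem exists_ofFn_eq {l : List (Fin N)} (hl : l.length = N) (h : ∀ z, z ∈ l) :
    ∃ σ : Equiv.Perm (Fin N), List.ofFn σ = l := by
  have hinj : Function.Injective fun i : Fin N => l.get (i.cast hl.symm) := fun i j hij => by
    have := List.nodup_iff_injective_get.1 (nodup_of_forall_mem hl h) hij
    simpa [Fin.ext_iff] using this
  refine ⟨Equiv.ofBijective _ (Finite.injective_iff_bijective.1 hinj), ?_⟩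
  refine List.ext_getElem (by simp [hl]) fun i _ _ => ?_
  simp

theorem wordSign_of_forall_mem {l : List (Fin N)} (hl : l.length = N) (h : ∀ z, z ∈ l) :
    wordSign F l = ((invSign (l.map Fin.val) : ℤ) : F) := by
  obtain ⟨σ, rfl⟩ := exists_ofFn_eq hl h
  rw [wordSign_ofFn, sign_eq_invSign]

theorem wordSign_of_not_mem {l : List (Fin N)} {z : Fin N} (h : z ∉ l) : wordSign F l = 0 := by
  refine Finset.sum_eq_zero fun σ _ => if_neg ?_
  rintro rfl
  exact h ((List.mem_ofFn' _ _).2 ⟨σ.symm z, by simp⟩)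

theorem wordSign_of_length_ne {l : List (Fin N)} (h : l.length ≠ N) : wordSign F l = 0 := by
  refine Finset.sum_eq_zero fun σ _ => if_neg ?_
  rintro rfl
  simp at h

theorem wordSign_of_not_nodup {l : List (Fin N)} (h : ¬ l.Nodup) : wordSign F l = 0 := by
  refine Finset.sum_eq_zero fun σ _ => if_neg ?_
  rintro rfl
  exact h (List.nodup_ofFn.2 σ.injective)

theorem not_nodup_of_hasRepeat {X : Type} {l : List X} (h : HasRepeat l) : ¬ l.Nodup := by
  obtain ⟨a, x, b, rfl⟩ := h
  simp [List.nodup_append]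

theorem wordSign_map (σ : Equiv.Perm (Fin N)) (l : List (Fin N)) :
    wordSign F (l.map σ) = ((Equiv.Perm.sign σ : ℤ) : F) * wordSign F l := by
  rw [wordSign, wordSign, Finset.mul_sum, ← Equiv.sum_comp (Equiv.mulLeft σ)]
  refine Finset.sum_congr rfl fun τ _ => ?_
  have : List.ofFn (σ * τ : Equiv.Perm (Fin N)) = (List.ofFn τ).map σ := by
    rw [List.map_ofFn]; rfl
  simp only [Equiv.coe_mulLeft, this, (List.map_injective_iff.2 σ.injective).eq_iff]
  split_ifs <;> simp

theorem wordSign_append_cons (a b c : List (Fin N)) (x : Fin N) (hx : x ∉ b) :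
    wordSign F (a ++ (b ++ x :: c)) = (-1) ^ b.length * wordSign F (a ++ x :: (b ++ c)) := by
  have hp : (b ++ x :: c).Perm (x :: (b ++ c)) := List.perm_middle
  have hp' := hp.append_left a
  by_cases hl : (a ++ (b ++ x :: c)).length = N
  · by_cases h : ∀ z, z ∈ a ++ (b ++ x :: c)
    · rw [wordSign_of_forall_mem F hl h, wordSign_of_forall_mem F (hp'.length_eq ▸ hl)
        fun z => hp'.mem_iff.1 (h z)]
      rw [List.map_append, List.map_append (l₁ := a), invSign_append_congr (s := (-1) ^ b.length)
        _ (hp.map _)]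
      · push_cast; rfl
      · have := invSign_append_cons (b.map Fin.val) (c.map Fin.val) x
          (by simpa [Fin.val_inj] using hx)
        simpa using this
    · push Not at h
      obtain ⟨z, hz⟩ := h
      rw [wordSign_of_not_mem F hz, wordSign_of_not_mem F fun h => hz (hp'.mem_iff.2 h), mul_zero]
  · rw [wordSign_of_length_ne F hl, wordSign_of_length_ne F fun h => hl (hp'.length_eq.trans h),
      mul_zero]

/-- The cocycle property. By pigeonhole a letter occurs twice; any deletion that keeps both copies
gives zero, and the other two terms cancel. -/
theorem sum_wordSign_eraseIdx (l : List (Fin N)) (hl : l.length = N + 1) :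
    ∑ i ∈ Finset.range (N + 1), (-1 : F) ^ i * wordSign F (l.eraseIdx i) = 0 := by
  have hnd : ¬ l.Nodup := fun h => by
    have := h.length_le_card
    simp [hl] at this
  -- The two copies are chosen with no further `x` between them, so that `wordSign_append_cons` can
  -- move one across `b`.
  obtain ⟨a, x, b, c, hxb, rfl⟩ : ∃ a x b c, x ∉ b ∧ l = a ++ x :: (b ++ x :: c) := by
    clear hl
    induction l with
    | nil => simp at hnd
    | cons y l ih =>
      by_cases hy : y ∈ l
      · obtain ⟨b, c, rfl, hb⟩ := List.eq_append_cons_of_mem hy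
        exact ⟨[], y, b, c, hb, rfl⟩
      · obtain ⟨a, x, b, c, h, rfl⟩ := ih fun h => hnd (List.nodup_cons.2 ⟨hy, h⟩)
        exact ⟨y :: a, x, b, c, h, rfl⟩
  have hlen : a.length + b.length + c.length + 1 = N := by simp at hl; omega
  rw [Finset.sum_eq_add a.length (a.length + 1 + b.length) (by omega)]
  · have h₁ : (a ++ x :: (b ++ x :: c)).eraseIdx a.length = a ++ (b ++ x :: c) := by
      rw [List.eraseIdx_append_of_length_le le_rfl]; simp
    have h₂ : (a ++ x :: (b ++ x :: c)).eraseIdx (a.length + 1 + b.length) =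
        a ++ x :: (b ++ c) := by
      rw [List.eraseIdx_append_of_length_le (by omega),
        show a.length + 1 + b.length - a.length = b.length + 1 by omega, List.eraseIdx_cons_succ,
        List.eraseIdx_append_of_length_le le_rfl]
      simp
    -- The deletion signs differ by `(-1)^(|b|+1)` and the words by `(-1)^|b|`.
    rw [h₁, h₂, wordSign_append_cons F a b c x hxb]
    ring
  · rintro i hi ⟨h₁, h₂⟩
    rw [wordSign_of_not_nodup, mul_zero]
    rcases Nat.lt_or_ge i a.length with h | h
    · rw [List.eraseIdx_append_of_lt_length h]
      simp [List.nodup_append]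
    · obtain ⟨j, rfl⟩ : ∃ j, i = a.length + (j + 1) := ⟨i - a.length - 1, by omega⟩
      rw [List.eraseIdx_append_of_length_le (by omega)]
      simp only [Nat.add_sub_cancel_left, List.eraseIdx_cons_succ]
      have : x ∈ (b ++ x :: c).eraseIdx j := by
        rcases Nat.lt_or_ge j b.length with h | h
        · rw [List.eraseIdx_append_of_lt_length h]; simp
        · obtain ⟨t, rfl⟩ : ∃ t, j = b.length + (t + 1) := ⟨j - b.length - 1, by omega⟩
          rw [List.eraseIdx_append_of_length_le (by omega)]; simp
      simp [List.nodup_append, this]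
  · intro h; simp at h; omega
  · intro h; simp at h; omega

end Signature

/-! ## Evaluation of functions on shuffles -/

section Shuffle

variable (F : Type u) [CommRing F] {X Y Z X' Y' Z' : Type}

theorem shuffle_nil_right (g : X → Y → Z) (xs : List X) : shuffle F g xs [] = 0 := by
  cases xs <;> simp [shuffle]

theorem shuffle_cons_cons (g : X → Y → Z) {x : X} {xs : List X} {y : Y} {ys : List Y}
    (h : xs = [] → ys ≠ []) :
    shuffle F g (x :: xs) (y :: ys) = Finsupp.mapDomain (List.cons (g x y))
      (shuffle F g xs (y :: ys) + ((-1 : ℤˣ) ^ xs.length) • shuffle F g (x :: xs) ys) := by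
  rw [shuffle]
  simpa using h

theorem shuffle_map (p : X → X') (q : Y → Y') (r : Z → Z') (g : X → Y → Z) (g' : X' → Y' → Z')
    (h : ∀ x y, r (g x y) = g' (p x) (q y)) (xs : List X) (ys : List Y) :
    Finsupp.mapDomain (List.map r) (shuffle F g xs ys) =
      shuffle F g' (xs.map p) (ys.map q) := by
  fun_induction shuffle F g xs ys with
  | case1 => simp [shuffle]
  | case2 => simp [shuffle]
  | case3 x y => simp [shuffle, h]
  | case4 x xs y ys hne ih₁ ih₂ =>
    rw [List.map_cons, List.map_cons, shuffle_cons_cons F g' (by simpa using hne),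
      ← List.map_cons (f := q), ← List.map_cons (f := p), ← ih₁, ← ih₂,
      ← Finsupp.mapDomain_comp]
    have : List.map r ∘ List.cons (g x y) = List.cons (g' (p x) (q y)) ∘ List.map r := by
      funext l; simp [h]
    rw [this, Finsupp.mapDomain_comp, Finsupp.mapDomain_add, List.length_map]
    congr 2
    exact LinearMap.map_smul_of_tower (Finsupp.lmapDomain F F (List.map r)) _ _

/-! ### Sums of a function over the words of a shuffle -/

variable {M : Type u} [AddCommGroup M] [Module F M]

/-- The sum of the values of a function on the words of a shuffle. -/
noncomputable def shuffleSum (g : X → Y → Z) (A : List Z → M) (xs : List X) (ys : List Y) : M :=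
  Finsupp.linearCombination F A (shuffle F g xs ys)

theorem shuffleSum_nil_left (g : X → Y → Z) (A : List Z → M) (ys : List Y) :
    shuffleSum F g A [] ys = 0 := by
  simp [shuffleSum, shuffle]

theorem shuffleSum_nil_right (g : X → Y → Z) (A : List Z → M) (xs : List X) :
    shuffleSum F g A xs [] = 0 := by
  simp [shuffleSum, shuffle_nil_right]

theorem shuffleSum_singleton (g : X → Y → Z) (A : List Z → M) (x : X) (y : Y) :
    shuffleSum F g A [x] [y] = A [g x y] := by
  simp [shuffleSum, shuffle]

theorem shuffleSum_cons_cons (g : X → Y → Z) (A : List Z → M) {x : X} {xs : List X} {y : Y}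
    {ys : List Y} (h : xs = [] → ys ≠ []) :
    shuffleSum F g A (x :: xs) (y :: ys) =
      shuffleSum F g (fun l => A (g x y :: l)) xs (y :: ys) +
        ((-1 : ℤˣ) ^ xs.length) • shuffleSum F g (fun l => A (g x y :: l)) (x :: xs) ys := by
  rw [shuffleSum, shuffle_cons_cons F g h, Finsupp.linearCombination_mapDomain, map_add,
    LinearMap.map_smul_of_tower]
  rfl

theorem shuffleSum_zero (g : X → Y → Z) (xs : List X) (ys : List Y) :
    shuffleSum F g (fun _ => (0 : M)) xs ys = 0 := by
  have : Finsupp.linearCombination F (fun _ : List Z => (0 : M)) = 0 := by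
    ext; simp
  rw [shuffleSum, this, LinearMap.zero_apply]

theorem shuffleSum_smul_right (g : X → Y → Z) (A : List Z → M) (c : F) (xs : List X)
    (ys : List Y) :
    shuffleSum F g (fun l => c • A l) xs ys = c • shuffleSum F g A xs ys := by
  have : Finsupp.linearCombination F (fun l => c • A l) =
      c • Finsupp.linearCombination F A := by
    ext; simp
  rw [shuffleSum, this, LinearMap.smul_apply, shuffleSum]

theorem shuffleSum_map (p : X → X') (q : Y → Y') (r : Z → Z') (g : X → Y → Z)
    (g' : X' → Y' → Z') (h : ∀ x y, r (g x y) = g' (p x) (q y)) (A : List Z' → M)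
    (xs : List X) (ys : List Y) :
    shuffleSum F g (fun l => A (l.map r)) xs ys = shuffleSum F g' A (xs.map p) (ys.map q) := by
  rw [shuffleSum, shuffleSum, ← shuffle_map F p q r g g' h, Finsupp.linearCombination_mapDomain]
  rfl

/-- Every letter of a word in a shuffle of `xs` and `ys` combines letters of `xs` and `ys`. -/
theorem shuffleSum_eq_zero (g : X → Y → Z) (A : List Z → M) (xs : List X) (ys : List Y)
    (hA : ∀ l, (∀ z ∈ l, ∃ x ∈ xs, ∃ y ∈ ys, z = g x y) → A l = 0) :
    shuffleSum F g A xs ys = 0 := by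
  fun_induction shuffle F g xs ys generalizing A with
  | case1 => exact shuffleSum_nil_left ..
  | case2 => exact shuffleSum_nil_right ..
  | case3 x y =>
    rw [shuffleSum_singleton]
    exact hA _ (by simp)
  | case4 x xs y ys hne ih₁ ih₂ =>
    rw [shuffleSum_cons_cons F g A (by simpa using hne), ih₁, ih₂, smul_zero, add_zero]
    all_goals
      intro l hl
      refine hA _ fun z hz => ?_
      rcases List.mem_cons.1 hz with rfl | hz
      · exact ⟨x, by simp, y, by simp, rfl⟩
      · obtain ⟨x', hx', y', hy', rfl⟩ := hl z hz
        exact ⟨x', by simp at hx' ⊢; tauto, y', by simp at hy' ⊢; tauto, rfl⟩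

theorem HasRepeat.cons {z : Z} {l : List Z} (h : HasRepeat l) : HasRepeat (z :: l) := by
  obtain ⟨a, x, b, rfl⟩ := h
  exact ⟨z :: a, x, b, rfl⟩

/-- The words in a shuffle of `x :: xs` and `y :: ys` start with `g x y`. -/
theorem shuffleSum_cons_head (g : X → Y → Z) (A : List Z → M) (hA : ∀ l, HasRepeat l → A l = 0)
    (x : X) (xs : List X) (y : Y) (ys : List Y) :
    shuffleSum F g (fun l => A (g x y :: l)) (x :: xs) (y :: ys) = 0 := by
  by_cases h : xs = [] ∧ ys = []
  · obtain ⟨rfl, rfl⟩ := h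
    rw [shuffleSum_singleton]
    exact hA _ ⟨[], _, [], rfl⟩
  · have h₀ : (fun l => A (g x y :: g x y :: l)) = fun _ => (0 : M) :=
      funext fun l => hA _ ⟨[], _, l, rfl⟩
    rw [shuffleSum_cons_cons F g _ (by tauto), h₀, shuffleSum_zero, shuffleSum_zero, smul_zero,
      add_zero]

/-- A shuffle with vertical steps is degenerate if the combined letters only depend on the
horizontal position. -/
theorem shuffleSum_eq_zero_of_const (g : X → Y → Z) (s : X → Z) (A : List Z → M)
    (hA : ∀ l, HasRepeat l → A l = 0) (xs : List X) (hg : ∀ x ∈ xs, ∀ y, g x y = s x)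
    (y y' : Y) (ys : List Y) : shuffleSum F g A xs (y :: y' :: ys) = 0 := by
  induction xs generalizing A with
  | nil => exact shuffleSum_nil_left ..
  | cons x xs ih =>
    rw [shuffleSum_cons_cons F g A (by simp), ih _ (fun l hl => hA _ hl.cons)
      (fun x hx => hg x (by simp [hx])), hg x (by simp) y, ← hg x (by simp) y',
      shuffleSum_cons_head F g A hA, smul_zero, add_zero]

theorem shuffleSum_singleton_right (g : X → Y → Z) (A : List Z → M) (x : X) (xs : List X)
    (y : Y) : shuffleSum F g A (x :: xs) [y] = A ((x :: xs).map fun x => g x y) := by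
  induction xs generalizing A x with
  | nil => exact shuffleSum_singleton ..
  | cons x' xs ih =>
    rw [shuffleSum_cons_cons F g A (by simp), ih, shuffleSum_nil_right, smul_zero, add_zero]
    rfl

/-- Leaving the first column early would put vertical steps into columns of constant value, which is
degenerate. So all vertical steps come first, each crossing all `xs.length` horizontal steps. -/
theorem shuffleSum_cons_const (g : X → Y → Z) (s : X → Z) (A : List Z → M)
    (hA : ∀ l, HasRepeat l → A l = 0) (k : X) (xs : List X) (hg : ∀ x ∈ xs, ∀ y, g x y = s x)
    (y : Y) (ys : List Y) :
    shuffleSum F g A (k :: xs) (y :: ys) =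
      ((-1 : ℤˣ) ^ (xs.length * ys.length)) • A ((y :: ys).map (g k) ++ xs.map s) := by
  induction ys generalizing A y with
  | nil =>
    rw [shuffleSum_singleton_right]
    have : (xs.map fun x => g x y) = xs.map s := List.map_congr_left fun x hx => hg x hx y
    simp [this]
  | cons y' ys ih =>
    rw [shuffleSum_cons_cons F g A (by simp), shuffleSum_eq_zero_of_const F g s _
      (fun l hl => hA _ hl.cons) xs hg, ih _ (fun l hl => hA _ hl.cons), zero_add, smul_smul,
      ← pow_add]
    congr 2
    rw [List.length_cons]
    ring

/-- If the combined letters depend on the vertical position only in the column of `k`, then all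
nondegenerate words of a shuffle have their vertical steps in this column. -/
theorem shuffleSum_append_cons_const (g : X → Y → Z) (s : X → Z) (A : List Z → M)
    (hA : ∀ l, HasRepeat l → A l = 0) (p : List X) (k : X) (q : List X)
    (hp : ∀ x ∈ p, ∀ y, g x y = s x) (hq : ∀ x ∈ q, ∀ y, g x y = s x) (y : Y) (ys : List Y) :
    shuffleSum F g A (p ++ k :: q) (y :: ys) = ((-1 : ℤˣ) ^ (q.length * ys.length)) •
      A (p.map s ++ ((y :: ys).map (g k) ++ q.map s)) := by
  induction p generalizing A with
  | nil => exact shuffleSum_cons_const F g s A hA k q hq y ys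
  | cons x p ih =>
    rw [List.cons_append, shuffleSum_cons_cons F g A (by simp), ih _ (fun l hl => hA _ hl.cons)
      (fun x hx => hp x (by simp [hx]))]
    -- A vertical step before the column of `k` would repeat the letter `s x`.
    have hv : shuffleSum F g (fun l => A (g x y :: l)) (x :: (p ++ k :: q)) ys = 0 := by
      cases ys with
      | nil => exact shuffleSum_nil_right ..
      | cons y' ys =>
        rw [hp x (by simp) y, ← hp x (by simp) y', shuffleSum_cons_head F g A hA]
    rw [hv, smul_zero, add_zero, hp x (by simp) y]
    rfl

/-- The words of a shuffle are cut at the index `j`, where a lattice path is at some `(a, b)` with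
`a + b = j`. -/
theorem shuffleSum_take_smul_drop (g : X → Y → Z) (A : List Z → F) (B : List Z → M)
    (hB : B [] = 0) (j : ℕ) (xs : List X) (ys : List Y) :
    shuffleSum F g (fun l => A (l.take (j + 1)) • B (l.drop j)) xs ys =
      ∑ ab ∈ Finset.HasAntidiagonal.antidiagonal j, ((-1 : ℤˣ) ^ ((xs.drop (ab.1 + 1)).length * ab.2)) •
        shuffleSum F g A (xs.take (ab.1 + 1)) (ys.take (ab.2 + 1)) •
          shuffleSum F g B (xs.drop ab.1) (ys.drop ab.2) := by
  rcases xs with _ | ⟨x, xs⟩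
  · simp [shuffleSum_nil_left]
  rcases ys with _ | ⟨y, ys⟩
  · simp [shuffleSum_nil_right]
  induction j generalizing A x xs y ys with
  | zero =>
    simp only [Finset.Nat.antidiagonal_zero, Finset.sum_singleton, mul_zero, pow_zero, one_smul,
      List.drop_zero, List.take_succ_cons, List.take_zero, zero_add, shuffleSum_singleton]
    by_cases h : xs = [] ∧ ys = []
    · obtain ⟨rfl, rfl⟩ := h
      simp [shuffleSum_singleton]
    · rw [shuffleSum_cons_cons F g _ (by tauto), shuffleSum_cons_cons F g B (by tauto), smul_add,
        smul_comm (A [g x y]), ← shuffleSum_smul_right, ← shuffleSum_smul_right]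
      rfl
  | succ j ih =>
    have ih' : ∀ (xs' : List X) (ys' : List Y),
        shuffleSum F g (fun l => A (g x y :: l.take (j + 1)) • B (l.drop j)) xs' ys' =
        ∑ ab ∈ Finset.HasAntidiagonal.antidiagonal j, ((-1 : ℤˣ) ^ ((xs'.drop (ab.1 + 1)).length * ab.2)) •
          shuffleSum F g (fun l => A (g x y :: l)) (xs'.take (ab.1 + 1)) (ys'.take (ab.2 + 1)) •
          shuffleSum F g B (xs'.drop ab.1) (ys'.drop ab.2) := by
      intro xs' ys'
      rcases xs' with _ | ⟨x', xs'⟩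
      · simp [shuffleSum_nil_left]
      rcases ys' with _ | ⟨y', ys'⟩
      · simp [shuffleSum_nil_right]
      exact ih (fun l => A (g x y :: l)) x' xs' y' ys'
    by_cases h : xs = [] ∧ ys = []
    · obtain ⟨rfl, rfl⟩ := h
      rw [shuffleSum_singleton, Finset.sum_eq_zero]
      · simp [hB]
      · rintro ⟨a, b⟩ hab
        rw [Finset.HasAntidiagonal.mem_antidiagonal] at hab
        rcases a with _ | a
        · obtain rfl : b = j + 1 := by simpa using hab
          simp [shuffleSum_nil_right]
        · simp [shuffleSum_nil_left]
    -- The front is split according to the first step of the path.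
    have hfront : ∀ ab ∈ Finset.HasAntidiagonal.antidiagonal (j + 1),
        ((-1 : ℤˣ) ^ (((x :: xs).drop (ab.1 + 1)).length * ab.2)) •
        shuffleSum F g A ((x :: xs).take (ab.1 + 1)) ((y :: ys).take (ab.2 + 1)) •
          shuffleSum F g B ((x :: xs).drop ab.1) ((y :: ys).drop ab.2) =
        ((-1 : ℤˣ) ^ ((xs.drop ab.1).length * ab.2)) •
          shuffleSum F g (fun l => A (g x y :: l)) (xs.take ab.1) ((y :: ys).take (ab.2 + 1)) •
          shuffleSum F g B ((x :: xs).drop ab.1) ((y :: ys).drop ab.2) +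
        ((-1 : ℤˣ) ^ ((xs.drop ab.1).length * ab.2 + (xs.take ab.1).length)) •
          shuffleSum F g (fun l => A (g x y :: l)) ((x :: xs).take (ab.1 + 1)) (ys.take ab.2) •
          shuffleSum F g B ((x :: xs).drop ab.1) ((y :: ys).drop ab.2) := by
      rintro ⟨a, b⟩ hab
      rw [Finset.HasAntidiagonal.mem_antidiagonal] at hab
      dsimp only at hab ⊢
      by_cases hne : xs.take a = [] → ys.take b ≠ []
      · rw [List.take_succ_cons, List.take_succ_cons, shuffleSum_cons_cons F g A hne, add_smul,
          smul_add, pow_add, mul_smul, smul_assoc, List.drop_succ_cons]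
      -- Here both truncated tails are empty although `a + b = j + 1`, so the cut lies beyond the
      -- end of one word and the back shuffle vanishes.
      · push Not at hne
        have : shuffleSum F g B ((x :: xs).drop a) ((y :: ys).drop b) = 0 := by
          simp only [List.take_eq_nil_iff] at hne
          rcases a with _ | a
          · obtain rfl : b = j + 1 := by simpa using hab
            have : ys = [] := by simpa using hne.2
            simp [this, shuffleSum_nil_right]
          · have : xs = [] := by simpa using hne.1
            simp [this, shuffleSum_nil_left]
        simp [this]
    -- A horizontal first step needs `a > 0` and a vertical one `b > 0`; the boundary terms have an
    -- empty front, and the rest is indexed by the antidiagonal of `j`.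
    rw [Finset.sum_congr rfl hfront, Finset.sum_add_distrib,
      Finset.Nat.sum_antidiagonal_succ (n := j), Finset.Nat.sum_antidiagonal_succ' (n := j)]
    rw [shuffleSum_cons_cons F g _ (by tauto)]
    simp only [List.take_succ_cons, List.drop_succ_cons, List.take_zero, shuffleSum_nil_left,
      shuffleSum_nil_right, zero_smul, smul_zero, zero_add]
    rw [ih', ih', Finset.smul_sum]
    congr 1
    refine Finset.sum_congr rfl fun ab _ => ?_
    rw [smul_smul, ← pow_add]
    congr 2
    rw [List.drop_succ_cons]
    -- A vertical first step crosses all horizontal steps: those of the front enter the front sign,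
    -- those of the back the cut sign.
    have : xs.length = (xs.take ab.1).length + (xs.drop ab.1).length := by
      rw [← List.length_append, List.take_append_drop]
    rw [this]
    ring

end Shuffle

/-! ## First letters of partial composites -/

section Letters

/-! ### Inversions of a word with a substituted block -/

theorem crossings_append_right (l l₁ l₂ : List ℕ) :
    crossings l (l₁ ++ l₂) = crossings l l₁ + crossings l l₂ := by
  simp [crossings, List.countP_append, List.sum_map_add]

theorem crossings_of_forall {l l' : List ℕ} (k : ℕ) (h : ∀ x ∈ l, ∀ y ∈ l', y < x ↔ k < x) :
    crossings l l' = l'.length * l.countP (k < ·) := by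
  induction l with
  | nil => simp [crossings]
  | cons x l ih =>
    have hx : l'.countP (· < x) = if k < x then l'.length else 0 := by
      split_ifs with hk
      · exact List.countP_eq_length.2 fun y hy => by simpa [h x (by simp) y hy]
      · exact List.countP_eq_zero.2 fun y hy => by
          simpa using fun hh => hk ((h x (by simp) y hy).1 hh)
    have := ih fun x hx => h x (by simp [hx])
    simp only [crossings, List.map_cons, List.sum_cons, List.countP_cons] at this ⊢
    rw [this, hx]
    by_cases hk : k < x <;> simp [hk, mul_add, add_comm]

theorem crossings_of_forall_left {l l' : List ℕ} (k : ℕ)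
    (h : ∀ x ∈ l, ∀ y ∈ l', y < x ↔ y < k) :
    crossings l l' = l.length * l'.countP (· < k) := by
  have : (l.map fun x => l'.countP (· < x)) = l.map fun _ => l'.countP (· < k) :=
    List.map_congr_left fun x hx => List.countP_congr fun y hy => by simpa using h x hx y hy
  rw [crossings, this]
  simp

/-- The signature of a word in which the letter `k` is replaced by a block. -/
theorem invSign_substitute (p q v : List ℕ) (k n : ℕ) (hp : k ∉ p) (hq : k ∉ q)
    (hv : ∀ y ∈ v, y ≤ n) (hlen : v.length = n + 1) (hk : (p ++ q).countP (· < k) = k) :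
    invSign (p.map (fun x => if x < k then x else x + n) ++
      (v.map (k + ·) ++ q.map (fun x => if x < k then x else x + n))) =
      (-1) ^ (n * (p.length + k)) * (invSign (p ++ k :: q) * invSign v) := by
  set s : ℕ → ℕ := fun x => if x < k then x else x + n with hs
  have hmono : ∀ x y, s x < s y ↔ x < y := fun x y => by simp only [hs]; split_ifs <;> omega
  have h₁ : crossings (p.map s) (v.map (k + ·)) = (n + 1) * p.countP (k < ·) := by
    rw [crossings_of_forall (k + n)]
    · rw [List.length_map, hlen, List.countP_map]
      congr 1
      refine List.countP_congr fun x hx => ?_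
      simp only [hs, Function.comp_apply, decide_eq_true_eq]
      split_ifs <;> omega
    · intro x' hx' y' hy'
      obtain ⟨x, hx, rfl⟩ := List.mem_map.1 hx'
      obtain ⟨y, hy, rfl⟩ := List.mem_map.1 hy'
      have := hv y hy
      have : x ≠ k := fun h => hp (h ▸ hx)
      simp only [hs]
      split_ifs <;> omega
  have h₂ : crossings (v.map (k + ·)) (q.map s) = (n + 1) * q.countP (· < k) := by
    rw [crossings_of_forall_left k]
    · rw [List.length_map, hlen, List.countP_map]
      congr 1
      refine List.countP_congr fun x hx => ?_
      simp only [hs, Function.comp_apply, decide_eq_true_eq]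
      split_ifs <;> omega
    · intro x' hx' y' hy'
      obtain ⟨x, hx, rfl⟩ := List.mem_map.1 hx'
      obtain ⟨y, hy, rfl⟩ := List.mem_map.1 hy'
      have := hv x hx
      have : y ≠ k := fun h => hq (h ▸ hy)
      simp only [hs]
      split_ifs <;> omega
  have h₃ : crossings p [k] = p.countP (k < ·) := by
    rw [crossings_of_forall k (by simp)]
    simp
  have h₄ : p.countP (k < ·) + p.countP (· < k) = p.length := by
    rw [List.length_eq_countP_add_countP (· < k), add_comm]
    congr 1
    refine List.countP_congr fun x hx => ?_
    have : x ≠ k := fun h => hp (h ▸ hx)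
    simp
    omega
  have h₅ : crossings p (k :: q) = crossings p [k] + crossings p q :=
    crossings_append_right p [k] q
  rw [List.countP_append] at hk
  rw [invSign_append, invSign_append, crossings_append_right, h₁, h₂,
    invSign_map fun x _ y _ => hmono x y, invSign_map fun x _ y _ => hmono x y,
    crossings_map fun x _ y _ => hmono y x, invSign_map (f := (k + ·)) (by simp),
    invSign_append p, invSign, h₅, h₃]
  -- Each inversion with `k` becomes `n + 1` inversions with the block. Since `k` letters lie below
  -- `k`, the number of inversions with `k` has the parity of `p.length + k`.
  have hsign : ((-1 : ℤˣ)) ^ ((n + 1) * p.countP (k < ·)) * (-1) ^ ((n + 1) * q.countP (· < k)) =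
      (-1) ^ (n * (p.length + k)) * ((-1) ^ q.countP (· < k) * (-1) ^ p.countP (k < ·)) := by
    simp only [← pow_add]
    rw [← h₄]
    clear h₁ h₂ h₃ h₄ h₅ hmono
    generalize p.countP (k < ·) = a
    generalize p.countP (· < k) = b at *
    generalize q.countP (· < k) = c at *
    rw [show n * (a + b + k) + (c + a) = (n + 1) * a + (n + 1) * c + 2 * (n * b) by rw [← hk]; ring,
      pow_add _ _ (2 * (n * b)), pow_mul _ 2]
    simp
  have hunits : ∀ s t r a b x c d e : ℤˣ, a * b = c * (d * e) →
      s * (t * r * b) * (a * x) = c * (s * (d * r) * (e * x) * t) := by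
    intro s t r a b x c d e h
    have h := congrArg Units.val h
    ext
    push_cast at h ⊢
    linear_combination (s * t * r * x : ℤ) * h
  rw [pow_add, pow_add _ (p.countP _)]
  exact hunits _ _ _ _ _ _ _ _ _ hsign

/-! ### Evaluation of the signature on composed first letters -/

variable {m : ℕ} (n : ℕ)

/-- The first letter of `u ∘_k v` in terms of the first letters of `u` and `v`. -/
def letterComp (k x : Fin (m + 1)) (y : Fin (n + 1)) : Fin (m + n + 1) :=
  if x = k then ⟨k + y, by omega⟩ else shiftLetter n k x

/-- The block of `v` stands at the beginning exactly when `u` starts with `k`. -/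
theorem permComp_apply_zero {n : ℕ} (k : Fin (m + 1)) (u : Equiv.Perm (Fin (m + 1)))
    (v : Equiv.Perm (Fin (n + 1))) : permComp k u v 0 = letterComp n k (u 0) (v 0) := by
  change permCompFun k u v 0 = _
  unfold permCompFun letterComp
  by_cases h : u 0 = k
  · have : u.symm k = 0 := by rw [← h, Equiv.symm_apply_apply]
    simp [h, this]
  · have : u.symm k ≠ 0 := fun h' => h (by rw [← h', Equiv.apply_symm_apply])
    have : 0 < (u.symm k : ℕ) := Nat.pos_of_ne_zero fun h => this (Fin.ext h)
    simp [h, this]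

theorem shiftLetter_val (k x : Fin (m + 1)) :
    (shiftLetter n k x : ℕ) = if (x : ℕ) < k then (x : ℕ) else x + n := by
  simp only [shiftLetter, Fin.lt_def]
  split_ifs <;> rfl

theorem letterComp_val (k x : Fin (m + 1)) (y : Fin (n + 1)) :
    (letterComp n k x y : ℕ) =
      if (x : ℕ) = k then (k : ℕ) + y else if (x : ℕ) < k then (x : ℕ) else x + n := by
  simp only [letterComp, Fin.ext_iff]
  split_ifs with h <;> simp_all [shiftLetter_val]

variable {n} (F : Type u) [CommRing F]

/-- A letter missing from either factor makes a letter of the composite alphabet missing from every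
word of the shuffle: the composite of `x` with `0`, respectively of `k` with `y`. -/
theorem shuffleSum_wordSign_eq_zero (k : Fin (m + 1)) {us : List (Fin (m + 1))}
    {vs : List (Fin (n + 1))} (h : ¬ ((∀ x, x ∈ us) ∧ ∀ y, y ∈ vs)) :
    shuffleSum F (letterComp n k) (wordSign F) us vs = 0 := by
  refine shuffleSum_eq_zero F _ _ _ _ fun l hl => ?_
  by_contra hne
  refine h ⟨fun x => ?_, fun y => ?_⟩
  · by_contra hx
    refine hne (wordSign_of_not_mem F (z := letterComp n k x 0) fun hz => ?_)
    obtain ⟨x', hx', y', -, he⟩ := hl _ hz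
    have : x ≠ x' := fun hh => hx (hh ▸ hx')
    have := Fin.val_ne_of_ne this
    have he := congrArg Fin.val he
    simp only [letterComp_val, Fin.val_zero] at he
    split_ifs at he <;> omega
  · by_contra hy
    refine hne (wordSign_of_not_mem F (z := letterComp n k k y) fun hz => ?_)
    obtain ⟨x', -, y', hy', he⟩ := hl _ hz
    have : y ≠ y' := fun hh => hy (hh ▸ hy')
    have := Fin.val_ne_of_ne this
    have he := congrArg Fin.val he
    simp only [letterComp_val] at he
    split_ifs at he <;> omega

theorem countP_lt_range (k N : ℕ) : (List.range N).countP (· < k) = min k N := by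
  induction N with
  | zero => simp
  | succ N ih =>
    rw [List.range_succ, List.countP_append, ih, List.countP_singleton]
    by_cases h : N < k <;> simp [h] <;> omega

/-- With `us = p ++ k :: q`, only the path with its vertical steps at `k` survives. Its sign
`(-1)^(|q|n)` and the substitution sign `(-1)^(n(|p|+k))` combine because `|p| + |q| = m`. -/
theorem shuffleSum_wordSign_of_forall_mem (k : Fin (m + 1)) {us : List (Fin (m + 1))}
    {vs : List (Fin (n + 1))} (hus : us.length = m + 1) (hvs : vs.length = n + 1)
    (hu : ∀ x, x ∈ us) (hv : ∀ y, y ∈ vs) :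
    shuffleSum F (letterComp n k) (wordSign F) us vs =
      ((-1 : ℤˣ) ^ (n * (m + k))) • (wordSign F us * wordSign F vs) := by
  have hnd := nodup_of_forall_mem hus hu
  have hcount : (us.map Fin.val).countP (· < (k : ℕ)) = k := by
    have hp : us.Perm (List.finRange (m + 1)) :=
      (List.perm_ext_iff_of_nodup hnd (List.nodup_finRange _)).2 fun x => by simp [hu x]
    rw [(hp.map Fin.val).countP_eq, List.map_coe_finRange_eq_range, countP_lt_range]
    omega
  rw [wordSign_of_forall_mem F hus hu, wordSign_of_forall_mem F hvs hv]
  obtain ⟨p, q, rfl⟩ := List.append_of_mem (hu k)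
  have hkp : k ∉ p := fun h => by
    rw [List.nodup_append] at hnd
    exact hnd.2.2 k h k (by simp) rfl
  have hkq : k ∉ q := fun h => by
    rw [List.nodup_append] at hnd
    exact (List.nodup_cons.1 hnd.2.1).1 h
  obtain ⟨y, ys, rfl⟩ : ∃ y ys, vs = y :: ys := by
    cases vs with
    | nil => simp at hvs
    | cons y ys => exact ⟨y, ys, rfl⟩
  have hlc : ∀ x, x ≠ k → ∀ y, letterComp n k x y = shiftLetter n k x := fun x hx y => by
    simp [letterComp, hx]
  rw [shuffleSum_append_cons_const F _ (shiftLetter n k) _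
    (fun l hl => wordSign_of_not_nodup F (not_nodup_of_hasRepeat hl)) p k q
    (fun x hx => hlc x fun h => hkp (h ▸ hx)) (fun x hx => hlc x fun h => hkq (h ▸ hx))]
  have hys : ys.length = n := by simpa using hvs
  generalize y :: ys = v at *
  rw [wordSign_of_forall_mem F]
  · have h₁ : ((p.map (shiftLetter n k) ++ (v.map (letterComp n k k) ++
        q.map (shiftLetter n k))).map Fin.val) =
        (p.map Fin.val).map (fun x => if x < (k : ℕ) then x else x + n) ++
        ((v.map Fin.val).map ((k : ℕ) + ·) ++
        (q.map Fin.val).map (fun x => if x < (k : ℕ) then x else x + n)) := by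
      simp only [List.map_append, List.map_map]
      refine congrArg₂ _ ?_ (congrArg₂ _ ?_ ?_)
      · exact List.map_congr_left fun x _ => shiftLetter_val n k x
      · exact List.map_congr_left fun y _ => by simp [letterComp_val]
      · exact List.map_congr_left fun x _ => shiftLetter_val n k x
    have h₂ : ((p.map Fin.val) ++ (q.map Fin.val)).countP (· < (k : ℕ)) = k := by
      simpa [List.countP_append] using hcount
    rw [h₁, invSign_substitute _ _ _ _ _ (by simpa [Fin.val_inj] using hkp)
      (by simpa [Fin.val_inj] using hkq) (by simp; omega) (by simpa using hvs) h₂]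
    have hpq : m = q.length + p.length := by simp at hus; omega
    have hexp : n * (m + k) = q.length * n + n * (p.length + k) := by
      have : n * (q.length + p.length + k) = q.length * n + n * (p.length + k) := by ring
      rwa [← hpq] at this
    rw [hexp, hys, List.length_map, List.map_append, List.map_cons, Units.smul_def,
      Units.smul_def, zsmul_eq_mul, zsmul_eq_mul, pow_add]
    push_cast
    ring
  · simp at hus hvs ⊢
    omega
  -- Letters from `k` to `k + n` come from the block, all others are shifted letters of `p` or `q`.
  · intro z
    have hz := z.isLt
    simp only [List.mem_append, List.mem_map]
    by_cases h : (z : ℕ) < k ∨ (k : ℕ) + n < z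
    · obtain ⟨x, hxk, hx⟩ : ∃ x, x ≠ k ∧ shiftLetter n k x = z := by
        rcases h with h | h
        · refine ⟨⟨z, by omega⟩, fun hh => ?_, ?_⟩
          · simp [← hh] at h
          · ext; simp [shiftLetter_val, h]
        · refine ⟨⟨z - n, by omega⟩, fun hh => ?_, ?_⟩
          · have := congrArg Fin.val hh
            simp at this
            omega
          · ext
            simp only [shiftLetter_val]
            split_ifs <;> omega
      have := hu x
      simp only [List.mem_append, List.mem_cons, hxk, false_or] at this
      rcases this with h | h
      · exact Or.inl ⟨x, h, hx⟩
      · exact Or.inr (Or.inr ⟨x, h, hx⟩)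
    · refine Or.inr (Or.inl ⟨⟨z - k, by omega⟩, hv _, ?_⟩)
      ext
      simp only [letterComp_val, if_true]
      omega

end Letters

/-! ## The cap product and the structure of the operad -/

section EraseIdx

/-! ### Deleting an entry before or after a cut -/

variable {X : Type} (l : List X)

theorem take_eraseIdx_of_lt {i m : ℕ} (h : i < m) :
    (l.eraseIdx i).take m = (l.take (m + 1)).eraseIdx i := by
  refine List.ext_getElem? fun j => ?_
  grind

theorem drop_eraseIdx_of_le {i m : ℕ} (h : i ≤ m) : (l.eraseIdx i).drop m = l.drop (m + 1) := by
  refine List.ext_getElem? fun j => ?_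
  grind

theorem take_eraseIdx_of_le {i m : ℕ} (h : m ≤ i) : (l.eraseIdx i).take m = l.take m := by
  refine List.ext_getElem? fun j => ?_
  grind

theorem drop_eraseIdx_add (i m : ℕ) : (l.eraseIdx (m + i)).drop m = (l.drop m).eraseIdx i := by
  refine List.ext_getElem? fun j => ?_
  grind

theorem eraseIdx_take_succ (m : ℕ) : (l.take (m + 1)).eraseIdx m = l.take m := by
  refine List.ext_getElem? fun j => ?_
  grind

end EraseIdx

section Cap

variable (F : Type u) [CommRing F] {X Y Z : Type} {M : Type u} [AddCommGroup M] [Module F M]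

variable {F} in
theorem chain_ext {φ ψ : Chain F X →ₗ[F] M} (h : ∀ l, φ (tuple F l) = ψ (tuple F l)) : φ = ψ :=
  Submodule.linearMap_qext _ (Finsupp.lhom_ext' fun l => LinearMap.ext_ring (h l))

theorem ez_tuple (g : X → Y → Z) (xs : List X) (ys : List Y) :
    ez F g (tuple F xs) (tuple F ys) = shuffleSum F g (tuple F) xs ys := by
  have : (degenerate F Z).mkQ = Finsupp.linearCombination F (tuple F) := by
    ext l; simp [tuple]
  rw [ez, lift_tuple, lift_tuple, ezTuple, this, shuffleSum]

theorem map_shuffleSum {M' : Type u} [AddCommGroup M'] [Module F M'] (φ : M →ₗ[F] M')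
    (g : X → Y → Z) (A : List Z → M) (xs : List X) (ys : List Y) :
    φ (shuffleSum F g A xs ys) = shuffleSum F g (fun l => φ (A l)) xs ys := by
  have : φ ∘ₗ Finsupp.linearCombination F A = Finsupp.linearCombination F fun l => φ (A l) := by
    ext l; simp
  exact LinearMap.congr_fun this _

variable {m : ℕ}

theorem fundamentalCochain_eq_wordSign (l : List (Equiv.Perm (Fin (m + 1)))) :
    fundamentalCochain F l = wordSign F (l.map fun w => w 0) := rfl

theorem cap_tuple (l : List (Equiv.Perm (Fin (m + 1)))) :
    cap F m (tuple F l) = fundamentalCochain F (l.take (m + 1)) • tuple F (l.drop m) :=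
  lift_tuple F _ _ _

/-- Faces omitting an entry after position `m` are the positive faces of the back. The others change
the front, and the cocycle property collects them into the zeroth face of the back. -/
theorem cap_boundary (c : Chain F (Equiv.Perm (Fin (m + 1)))) :
    cap F m (boundary F c) = ((-1 : ℤˣ) ^ m) • boundary F (cap F m c) := by
  revert c
  refine LinearMap.congr_fun (chain_ext
    (φ := cap F m ∘ₗ boundary F) (ψ := ((-1 : ℤˣ) ^ m) • (boundary F ∘ₗ cap F m)) fun l => ?_)
  rw [LinearMap.smul_apply, LinearMap.comp_apply, LinearMap.comp_apply, cap_tuple, map_smul]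
  simp only [boundary, lift_tuple, boundaryTuple, map_sum, LinearMap.map_smul_of_tower, cap_tuple]
  rcases Nat.lt_or_ge m l.length with hl | hl
  swap
  · rw [fundamentalCochain_eq_zero F _ (Or.inl (by simp; omega)), zero_smul, smul_zero]
    refine Finset.sum_eq_zero fun i _ => ?_
    rw [fundamentalCochain_eq_zero F _ (Or.inl ?_), zero_smul, smul_zero]
    have := List.length_eraseIdx_le l i
    simp
    omega
  obtain ⟨t, ht⟩ : ∃ t, l.length = m + 1 + t := ⟨l.length - (m + 1), by omega⟩
  have hlow : ∀ i ∈ Finset.range (m + 1), ((-1 : ℤˣ) ^ i) •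
      fundamentalCochain F ((l.eraseIdx i).take (m + 1)) • tuple F ((l.eraseIdx i).drop m) =
      ((-1 : F) ^ i * fundamentalCochain F ((l.take (m + 2)).eraseIdx i)) •
        tuple F (l.drop (m + 1)) := by
    intro i hi
    have hi := Finset.mem_range.1 hi
    have h₁ : (l.eraseIdx i).take (m + 1) = (l.take (m + 2)).eraseIdx i :=
        take_eraseIdx_of_lt l hi
    have h₂ : (l.eraseIdx i).drop m = l.drop (m + 1) :=
        drop_eraseIdx_of_le l (by omega)
    rw [h₁, h₂, mul_smul, Units.smul_def, ← Int.cast_smul_eq_zsmul F]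
    simp
  have hhigh : ∀ i, ((-1 : ℤˣ) ^ (m + 1 + i)) •
      fundamentalCochain F ((l.eraseIdx (m + 1 + i)).take (m + 1)) •
        tuple F ((l.eraseIdx (m + 1 + i)).drop m) =
      ((-1 : ℤˣ) ^ m) • fundamentalCochain F (l.take (m + 1)) •
        ((-1 : ℤˣ) ^ (i + 1)) • tuple F ((l.drop m).eraseIdx (i + 1)) := by
    intro i
    have h₁ : (l.eraseIdx (m + 1 + i)).take (m + 1) = l.take (m + 1) :=
        take_eraseIdx_of_le l (by omega)
    have h₂ : (l.eraseIdx (m + 1 + i)).drop m = (l.drop m).eraseIdx (i + 1) :=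
        by rw [add_assoc, add_comm 1, drop_eraseIdx_add]
    rw [h₁, h₂, smul_comm (fundamentalCochain F _), smul_smul, ← pow_add,
      show m + (i + 1) = m + 1 + i by ring]
  -- The cocycle sum over the first `m + 2` entries has one more term, the original front with sign
  -- `(-1)^(m+1)`. If there are only `m + 1` entries, the zeroth face of the back is empty and hence
  -- zero.
  have hcocycle : (∑ i ∈ Finset.range (m + 1),
      (-1 : F) ^ i * fundamentalCochain F ((l.take (m + 2)).eraseIdx i)) •
        tuple F (l.drop (m + 1)) =
      ((-1 : ℤˣ) ^ m) • fundamentalCochain F (l.take (m + 1)) • tuple F (l.drop (m + 1)) := by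
    rcases t with _ | t
    · rw [tuple_eq_zero F (Or.inl (by simp [ht])), smul_zero, smul_zero, smul_zero]
    · have := sum_wordSign_eraseIdx F ((l.take (m + 2)).map fun w => w 0) (by simp; omega)
      rw [Finset.sum_range_succ] at this
      simp only [List.eraseIdx_map, ← fundamentalCochain_eq_wordSign] at this
      have h : (l.take (m + 2)).eraseIdx (m + 1) = l.take (m + 1) :=
        eraseIdx_take_succ l _
      rw [eq_neg_of_add_eq_zero_left this, h, Units.smul_def, ← Int.cast_smul_eq_zsmul F,
        smul_smul]
      push_cast
      ring_nf
  rw [ht, Finset.sum_range_add, Finset.sum_congr rfl hlow, ← Finset.sum_smul, hcocycle,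
    Finset.sum_congr rfl fun i _ => hhigh i, List.length_drop,
    show l.length - m = t + 1 by omega, Finset.sum_range_succ', smul_add, smul_add, Finset.smul_sum,
    Finset.smul_sum]
  simp [add_comm]

theorem cap_mapTuple (σ : Equiv.Perm (Fin (m + 1))) (c : Chain F (Equiv.Perm (Fin (m + 1)))) :
    cap F m (mapTuple F (fun w => σ * w) c) =
      Equiv.Perm.sign σ • mapTuple F (fun w => σ * w) (cap F m c) := by
  revert c
  refine LinearMap.congr_fun (chain_ext (φ := cap F m ∘ₗ mapTuple F (fun w => σ * w))
    (ψ := Equiv.Perm.sign σ • (mapTuple F (fun w => σ * w) ∘ₗ cap F m)) fun l => ?_)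
  rw [LinearMap.smul_apply, LinearMap.comp_apply, LinearMap.comp_apply, cap_tuple, map_smul,
    mapTuple, lift_tuple, lift_tuple, cap_tuple, ← List.map_take, ← List.map_drop,
    fundamentalCochain_eq_wordSign, fundamentalCochain_eq_wordSign, List.map_map]
  have h : ((fun w : Equiv.Perm (Fin (m + 1)) => w 0) ∘ fun w => σ * w) = σ ∘ fun w => w 0 := rfl
  rw [h, ← List.map_map, wordSign_map, mul_smul, Int.cast_smul_eq_zsmul, Units.smul_def]

theorem cap_one : cap F 0 (tuple F [1]) = tuple F [1] := by
  have h : fundamentalCochain F [(1 : Equiv.Perm (Fin (0 + 1)))] = 1 := by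
    simp [fundamentalCochain]
  rw [cap_tuple]
  simp [h]

theorem fundamentalCochain_shuffleSum {n : ℕ} (k : Fin (m + 1))
    (xs : List (Equiv.Perm (Fin (m + 1)))) (ys : List (Equiv.Perm (Fin (n + 1)))) :
    shuffleSum F (permComp k) (fundamentalCochain F) xs ys =
      shuffleSum F (letterComp n k) (wordSign F) (xs.map fun w => w 0) (ys.map fun w => w 0) :=
  shuffleSum_map F _ _ _ _ _ (fun x y => permComp_apply_zero k x y) (wordSign F) xs ys

/-- The first exponent comes from the front word, the second from the `n` vertical front steps
crossing the horizontal back steps. Truncated subtraction is harmless: for shorter `xs` the cap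
product is zero. -/
theorem cap_ez_tuple {n : ℕ} (k : Fin (m + 1)) (xs : List (Equiv.Perm (Fin (m + 1))))
    (ys : List (Equiv.Perm (Fin (n + 1)))) :
    cap F (m + n) (ez F (permComp k) (tuple F xs) (tuple F ys)) =
      ((-1 : ℤˣ) ^ (n * (m + k) + n * (xs.length - (m + 1)))) •
        ez F (permComp k) (cap F m (tuple F xs)) (cap F n (tuple F ys)) := by
  have hempty : tuple F ([] : List (Equiv.Perm (Fin (m + n + 1)))) = 0 :=
    tuple_eq_zero F (Or.inl rfl)
  rw [ez_tuple, map_shuffleSum]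
  simp only [cap_tuple]
  rw [shuffleSum_take_smul_drop F _ _ _ hempty, Finset.sum_eq_single (m, n)]
  · rw [fundamentalCochain_shuffleSum, map_smul, map_smul, LinearMap.smul_apply, ez_tuple]
    have hfront : shuffleSum F (letterComp n k) (wordSign F)
        ((xs.take (m + 1)).map fun w => w 0) ((ys.take (n + 1)).map fun w => w 0) =
        ((-1 : ℤˣ) ^ (n * (m + k))) • (fundamentalCochain F (xs.take (m + 1)) *
          fundamentalCochain F (ys.take (n + 1))) := by
      by_cases h : (∀ x, x ∈ (xs.take (m + 1)).map fun w => w 0) ∧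
          ∀ y, y ∈ (ys.take (n + 1)).map fun w => w 0
      · have hx := le_length_of_forall_mem h.1
        have hy := le_length_of_forall_mem h.2
        simp only [List.length_map, List.length_take] at hx hy
        exact shuffleSum_wordSign_of_forall_mem F k (by simp; omega) (by simp; omega) h.1 h.2
      · rw [shuffleSum_wordSign_eq_zero F k h, fundamentalCochain_eq_wordSign,
          fundamentalCochain_eq_wordSign]
        rw [not_and_or] at h
        push Not at h
        rcases h with ⟨x, hx⟩ | ⟨y, hy⟩
        · rw [wordSign_of_not_mem F hx, zero_mul, smul_zero]
        · rw [wordSign_of_not_mem F hy, mul_zero, smul_zero]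
    rw [hfront, List.length_drop, smul_assoc, smul_smul, ← pow_add, mul_smul,
      smul_comm (fundamentalCochain F (xs.take (m + 1))), mul_comm _ n, add_comm (n * (m + k))]
  -- The fronts have at most `a + 1` and `b + 1` entries with `a + b = m + n`, so away from `(m, n)`
  -- one of them misses a letter.
  · rintro ⟨a, b⟩ hab hne
    rw [Finset.HasAntidiagonal.mem_antidiagonal] at hab
    rw [fundamentalCochain_shuffleSum, shuffleSum_wordSign_eq_zero, zero_smul, smul_zero]
    rintro ⟨hx, hy⟩
    have h₁ := le_length_of_forall_mem hx
    have h₂ := le_length_of_forall_mem hy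
    simp only [List.length_map, List.length_take] at h₁ h₂
    refine hne (Prod.ext ?_ ?_) <;> dsimp only at hab ⊢ <;> omega
  · simp

end Cap

/-- The sign depends only on the degree of the first factor, so only that factor is taken
homogeneous. -/
theorem cap_ez (F : Type u) [CommRing F] {m n : ℕ} (k : Fin (m + 1)) (d : ℤ)
    (a : Chain F (Equiv.Perm (Fin (m + 1)))) (ha : a ∈ deg F (Equiv.Perm (Fin (m + 1))) d)
    (b : Chain F (Equiv.Perm (Fin (n + 1)))) :
    cap F (m + n) (ez F (permComp k) a b) =
      ((-1 : ℤˣ) ^ (n * (m + k)) * ((-1 : ℤˣ) ^ (d - m)) ^ n) •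
        ez F (permComp k) (cap F m a) (cap F n b) := by
  set s : ℤˣ := (-1 : ℤˣ) ^ (n * (m + k)) * ((-1 : ℤˣ) ^ (d - m)) ^ n with hs
  refine sub_eq_zero.1 ?_
  have h := map_mem F (M := Chain F (Equiv.Perm (Fin (m + n + 1))))
    (cap F (m + n) ∘ₗ (ez F (permComp k)).flip b -
      s • ((ez F (permComp k)).flip (cap F n b) ∘ₗ cap F m)) ⊥ d (fun xs hxs => ?_) a ha
  · exact (Submodule.mem_bot F).1 h
  rw [Submodule.mem_bot, LinearMap.sub_apply, sub_eq_zero]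
  refine LinearMap.congr_fun (chain_ext (φ := cap F (m + n) ∘ₗ ez F (permComp k) (tuple F xs))
    (ψ := s • (ez F (permComp k) (cap F m (tuple F xs)) ∘ₗ cap F n)) fun ys => ?_) b
  rw [LinearMap.smul_apply, LinearMap.comp_apply, LinearMap.comp_apply, cap_ez_tuple]
  rcases Nat.lt_or_ge m xs.length with h | h
  · have hd : d - m = ((xs.length - (m + 1) : ℕ) : ℤ) := by omega
    rw [hs, hd, zpow_natCast, ← pow_mul, ← pow_add, mul_comm (xs.length - _)]
  · rw [cap_tuple F xs, fundamentalCochain_eq_zero F _ (Or.inl (by simp; omega))]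
    simp

end BarrattEccles

/-! ### The morphism of operads and its normalizing sign -/

theorem proposition3p2p9 (F : Type*) [CommRing F] :
    IsDGOperadMorphism (barrattEccles F) (operadicSuspension (barrattEccles F))
      (fun m d => ((-1 : ℤˣ) ^ (m * (m + 1) / 2)) • capFundamental F m d) := by
  refine ⟨fun m d d' h p => Subtype.ext ?_, fun m d σ p => Subtype.ext ?_,
    fun d h => Subtype.ext ?_, fun m n k d e f h p q => Subtype.ext ?_⟩
  · change ((-1 : ℤˣ) ^ (m * (m + 1) / 2)) • BarrattEccles.cap F m (BarrattEccles.boundary F p.1) =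
      ((-1 : ℤˣ) ^ m) • BarrattEccles.boundary F
        (((-1 : ℤˣ) ^ (m * (m + 1) / 2)) • BarrattEccles.cap F m p.1)
    rw [BarrattEccles.cap_boundary, LinearMap.map_smul_of_tower, smul_comm]
  · change ((-1 : ℤˣ) ^ (m * (m + 1) / 2)) •
        BarrattEccles.cap F m (BarrattEccles.mapTuple F (fun w => σ * w) p.1) =
      Equiv.Perm.sign σ • BarrattEccles.mapTuple F (fun w => σ * w)
        (((-1 : ℤˣ) ^ (m * (m + 1) / 2)) • BarrattEccles.cap F m p.1)
    rw [BarrattEccles.cap_mapTuple, LinearMap.map_smul_of_tower, smul_comm]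
  · change ((-1 : ℤˣ) ^ (0 * (0 + 1) / 2)) • BarrattEccles.cap F 0 (BarrattEccles.tuple F [1]) =
      BarrattEccles.tuple F [1]
    rw [BarrattEccles.cap_one]
    simp
  · change ((-1 : ℤˣ) ^ ((m + n) * (m + n + 1) / 2)) •
        BarrattEccles.cap F (m + n) (BarrattEccles.ez F (BarrattEccles.permComp k) p.1 q.1) =
      ((-1 : ℤˣ) ^ (n * (k : ℕ)) * ((-1 : ℤˣ) ^ (d - m)) ^ n) •
        BarrattEccles.ez F (BarrattEccles.permComp k)
          (((-1 : ℤˣ) ^ (m * (m + 1) / 2)) • BarrattEccles.cap F m p.1)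
          (((-1 : ℤˣ) ^ (n * (n + 1) / 2)) • BarrattEccles.cap F n q.1)
    rw [BarrattEccles.cap_ez F k d p.1 p.2, LinearMap.map_smul_of_tower,
      LinearMap.map_smul_of_tower, LinearMap.smul_apply, smul_smul, smul_smul, smul_smul]
    congr 1
    -- The triangular numbers are additive up to `m * n`, which cancels the factor `(-1)^(nm)` left
    -- over in `cap_ez`.
    have htri : (m + n) * (m + n + 1) / 2 = m * (m + 1) / 2 + n * (n + 1) / 2 + m * n := by
      obtain ⟨a, ha⟩ := even_iff_two_dvd.1 (Nat.even_mul_succ_self m)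
      obtain ⟨b, hb⟩ := even_iff_two_dvd.1 (Nat.even_mul_succ_self n)
      have : (m + n) * (m + n + 1) = 2 * (a + b + m * n) := by
        have : (m + n) * (m + n + 1) = m * (m + 1) + n * (n + 1) + 2 * (m * n) := by ring
        rw [this, ha, hb]
        ring
      rw [this, ha, hb]
      simp
    have hsq : (-1 : ℤˣ) ^ (m * n) * (-1) ^ (n * m) = 1 := by
      rw [mul_comm n m, ← mul_pow]
      simp
    rw [htri, mul_add n m, pow_add, pow_add, pow_add]
    generalize ((-1 : ℤˣ) ^ (d - m)) ^ n = z
    calc _ = ((-1 : ℤˣ) ^ (m * n) * (-1) ^ (n * m)) * ((-1) ^ (n * (k : ℕ)) * z *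
          (-1) ^ (m * (m + 1) / 2) * (-1) ^ (n * (n + 1) / 2)) := by
          simp only [mul_assoc, mul_comm, mul_left_comm]
      _ = _ := by rw [hsq, one_mul, mul_right_comm]
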